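/- Let $n\ge 2$, $m\ge 1$, and let $\Omega\subset\mathbb{R}^n$ be open, bounded and connected with $0\in\Omega$. Assume that $\Omega$ is convex in the $x_1$-direction (if $p,q\in\Omega$ satisfy $p_j=q_j$ for all $j\ge 2$, then the segment from $p$ to $q$ lies in $\Omega$) and symmetric under $(x_1,x_2,\dots,x_n)\mapsto(-x_1,x_2,\dots,x_n)$. Let $\alpha=(\alpha_1,\dots,\alpha_m)\in\mathbb{R}^m$ and define $s_0(\alpha),\dots,s_m(\alpha)$ by $\prod_{i=1}^m(\alpha_i+t)=\sum_{k=0}^m s_k(\alpha)t^k$, that is, $s_m(\alpha)=1$ and $$s_k(\alpha)=\sum_{1\le i_1<\dots<i_{m-k}\le m}\alpha_{i_1}\cdots\alpha_{i_{m-k}}\qquad(0\le k\le m-1).$$ Assume $s_0(\alpha),\dots,s_{m-1}(\alpha)\ge 0$. Let $f:[0,\infty)\to\mathbb{R}$ be globally Lipschitz continuous and non-decreasing, with $f(0)\ge 0$. Let $u\in C^{2m}(\Omega\setminus\{0\})\cap C^{2m-2}(\overline\Omega\setminus\{0\})$ satisfy $$\begin{cases}\displaystyle\sum_{k=0}^m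 s_k(\alpha)(-\Delta)^k u=f(u) & \text{in }\Omega\setminus\{0\},\\ u>0 & \text{in }\Omega\setminus\{0\},\\ u=-\Delta u=\dots=(-\Delta)^{m-1}u=0 & \text{on }\partial\Omega,\\ \displaystyle\inf_{\Omega\setminus\{0\}}(-\Delta)^j u>-\infty & \text{for } j=1,\dots,m-1.\end{cases}$$ Here $u\in C^{2m-2}(\overline\Omega\setminus\{0\})$ means that all derivatives of $u$ of order at most $2m-2$ extend continuously to $\overline\Omega\setminus\{0\}$, and the boundary values are those of the extensions. Then: 1. $u$ is symmetric in $x_1$: $u(-x_1,x_2,\dots,x_n)=u(x_1,x_2,\dots,x_n)$ for every $x\in\Omega\setminus\{0\}$. 2. $u$ is strictly decreasing in $x_1$ on $\Omega\cap\{x_1>0\}$: if $p,q\in\Omega$ satisfy $p_j=q_j$ for all $j\ge2$ and $0<p_1<q_1$, then $u(q)<u(p)$. -/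

import Mathlib

open Set Filter Topology

/-- Reflection across the hyperplane `{x₁ = 0}`: `(x₁, x₂, …, xₙ) ↦ (-x₁, x₂, …, xₙ)`.
The first coordinate `x₁` is `x 0`. -/
def reflectX1 {n : ℕ} [NeZero n] (x : EuclideanSpace ℝ (Fin n)) : EuclideanSpace ℝ (Fin n) :=
  WithLp.toLp 2 (fun j => if j = 0 then -x j else x j)

/-- A bounded domain (bounded, open, connected set) of `ℝⁿ` that is convex in the
`x₁`-direction, symmetric with respect to `{x₁ = 0}`, and contains the origin. -/
structure IsSymmetricX1Domain {n : ℕ} [NeZero n] (Ω : Set (EuclideanSpace ℝ (Fin n))) :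
    Prop where
  isOpen : IsOpen Ω
  isBounded : Bornology.IsBounded Ω
  isConnected : IsConnected Ω
  convexX1 : ∀ p ∈ Ω, ∀ q ∈ Ω, (∀ j, j ≠ 0 → p j = q j) →
    ∀ t ∈ Icc (0 : ℝ) 1, (1 - t) • p + t • q ∈ Ω
  symmetric : ∀ p ∈ Ω, reflectX1 p ∈ Ω
  zero_mem : (0 : EuclideanSpace ℝ (Fin n)) ∈ Ω

/-- `(-Δ)^j u`, the `j`-fold iterate of minus the Laplacian. -/
noncomputable def negLaplacianPow {n : ℕ} (j : ℕ) (u : EuclideanSpace ℝ (Fin n) → ℝ) :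
    EuclideanSpace ℝ (Fin n) → ℝ :=
  (fun v : EuclideanSpace ℝ (Fin n) → ℝ => -Laplacian.laplacian v)^[j] u

/-- For `k ≤ m`, `s_k(α)` is the elementary symmetric function of degree `m - k` of
`α₁, …, α_m`; in particular `s_m(α) = 1`. -/
def symmCoeff {m : ℕ} (α : Fin m → ℝ) (k : ℕ) : ℝ :=
  ∑ S ∈ Finset.powersetCard (m - k) (Finset.univ : Finset (Fin m)), ∏ i ∈ S, α i

/-- The `s_k(α)` are the coefficients of `det diag(α₁ + t, …, α_m + t)`. -/
theorem det_diagonal_add_eq_sum_symmCoeff {m : ℕ} (α : Fin m → ℝ) (t : ℝ) :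
    (Matrix.diagonal (fun i => α i + t)).det =
      ∑ k ∈ Finset.range (m + 1), symmCoeff α k * t ^ k := by
  rw [Matrix.det_diagonal, Finset.prod_add, Finset.sum_powerset]
  rw [← Finset.sum_range_reflect]
  simp only [Finset.card_univ, Fintype.card_fin]
  refine Finset.sum_congr rfl fun k hk => ?_
  have hk' : k ≤ m := by simpa [Nat.lt_succ_iff] using hk
  rw [symmCoeff, Finset.sum_mul]
  have e : m + 1 - 1 - k = m - k := by omega
  rw [e]
  refine Finset.sum_congr rfl fun S hS => ?_
  rw [Finset.mem_powersetCard] at hS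
  rw [Finset.prod_const, Finset.card_sdiff_of_subset (Finset.subset_univ S), hS.2]
  have e2 : (Finset.univ : Finset (Fin m)).card - (m - k) = k := by simp; omega
  rw [e2]

/-- Regularity up to the boundary away from the origin: `u ∈ C^r(Ω̄ ∖ {0})`. That is, `u` is of
class `C^r` on `Ω ∖ {0}` and each derivative of order at most `r` extends continuously to
`Ω̄ ∖ {0}`. Only the values of `u` on `Ω ∖ {0}` matter (for open `Ω`). -/
def IsCrUpToBoundary {n : ℕ} (r : ℕ) (Ω : Set (EuclideanSpace ℝ (Fin n)))
    (u : EuclideanSpace ℝ (Fin n) → ℝ) : Prop :=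
  ContDiffOn ℝ (r : WithTop ℕ∞) u (Ω \ {0}) ∧
  ∀ k : ℕ, k ≤ r →
    ∃ g : EuclideanSpace ℝ (Fin n) →
        ContinuousMultilinearMap ℝ (fun _ : Fin k => EuclideanSpace ℝ (Fin n)) ℝ,
      ContinuousOn g (closure Ω \ {0}) ∧ ∀ x ∈ Ω \ {0}, g x = iteratedFDeriv ℝ k u x

/-- Global Lipschitz continuity on `[0, ∞)`, `f(0) ≥ 0`, and monotonicity. -/
structure IsAdmissibleNonlinearity (f : ℝ → ℝ) : Prop where
  lipschitz : ∃ K : NNReal, LipschitzOnWith K f (Ici 0)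
  zero_nonneg : 0 ≤ f 0
  monotone : MonotoneOn f (Ici 0)

/-- `u ∈ C^{2m}(Ω ∖ {0}) ∩ C^{2m-2}(Ω̄ ∖ {0})` is a positive classical solution of
`∑ₖ s_k(α) (-Δ)^k u = f(u)` in `Ω ∖ {0}` with Navier boundary conditions
`u = -Δu = ⋯ = (-Δ)^{m-1}u = 0` on `∂Ω` and with `(-Δ)^j u` bounded below for `1 ≤ j ≤ m - 1`.
The value on `∂Ω` of `(-Δ)^j u` is the one of its continuous extension, i.e. its limit. -/
structure IsPositiveNavierSolution {n m : ℕ} (α : Fin m → ℝ) (f : ℝ → ℝ)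
    (Ω : Set (EuclideanSpace ℝ (Fin n))) (u : EuclideanSpace ℝ (Fin n) → ℝ) : Prop where
  contDiffOn : ContDiffOn ℝ ((2 * m : ℕ) : WithTop ℕ∞) u (Ω \ {0})
  upToBoundary : IsCrUpToBoundary (2 * m - 2) Ω u
  equation : ∀ x ∈ Ω \ {0},
    ∑ k ∈ Finset.range (m + 1), symmCoeff α k * negLaplacianPow k u x = f (u x)
  pos : ∀ x ∈ Ω \ {0}, 0 < u x
  navier : ∀ j < m, ∀ y ∈ frontier Ω, Tendsto (negLaplacianPow j u) (𝓝[Ω \ {0}] y) (𝓝 0)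
  boundedBelow : ∀ j, 1 ≤ j → j < m → BddBelow (negLaplacianPow j u '' (Ω \ {0}))

/-! A monic polynomial with nonnegative coefficients has no positive root, so every `α i` is
nonnegative and the operator factors as `∏ (-Δ + αⱼ)`, each factor obeying the minimum principle.
The partial products applied to `u` form a chain `U₀ = u, …, U_m = f(u)` with `-ΔUᵢ + αᵢUᵢ = Uᵢ₊₁`,
in which every `Uᵢ` with `i < m` has zero boundary values and a lower bound
(`IsPositiveNavierSolution.isCooperativeSystem`). Since `f ≥ 0`, all `Uᵢ` are nonnegative.

The moving plane method is run on all `Uᵢ` at once. On the cap `{x₁ > c}`, `c > 0`, the differences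
`Wᵢ` (reflected value minus value) satisfy `ΔWᵢ = αᵢWᵢ - Wᵢ₊₁`, and `W_m ≥ 0` wherever `W₀ ≥ 0`
because `f` is monotone. The puncture reappears at the mirror image of the origin, where `Wᵢ` is
only bounded below; in dimension at least two a logarithmic barrier removes it
(`abp_estimate_of_pole`).

The engine is `IsCooperativeSystem.exists_small`. The Aleksandrov–Bakelman–Pucci estimate bounds the
negative part of `Wᵢ` by that of `Wᵢ₊₁`, with a factor governed by the measure of the set where
`Wᵢ₊₁` may be negative. If `W₀ ≥ 0` off a small set, one circuit through the chain halves the lower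
bound for `W₀`, so nothing negative remains.

The strong maximum principle then makes `W₀` strictly positive
(`IsCooperativeSystem.reflectDiff_pos`), so a plane at any `μ > 0` can be moved further: `W₀` stays
positive on a large compact set and the rest has small measure. Reflection in midpoint planes gives
strict monotonicity; letting `c → 0` for `u` and for its mirror image gives symmetry. -/

theorem IsLocalMin.fderiv_fderiv_nonneg {E : Type*} [NormedAddCommGroup E] [NormedSpace ℝ E]
    {f : E → ℝ} {x : E} (hf : ContDiffAt ℝ 2 f x)
    (hmin : IsLocalMin f x) (v : E) : 0 ≤ fderiv ℝ (fderiv ℝ f) x v v := by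
  set g : ℝ → ℝ := fun t => f (x + t • v) with hg
  have hline : ∀ t : ℝ, HasDerivAt (fun t : ℝ => x + t • v) v t := fun t => by
    simpa using ((hasDerivAt_id t).smul_const v).const_add x
  have hcont : Tendsto (fun t : ℝ => x + t • v) (𝓝 0) (𝓝 x) := by
    have := (hline 0).continuousAt.tendsto
    simpa using this
  have hdiff : ∀ᶠ y in 𝓝 x, DifferentiableAt ℝ f y :=
    (hf.eventually (by simp)).mono fun y hy => hy.differentiableAt (by norm_num)
  have hd1 : ∀ᶠ t in 𝓝 (0 : ℝ), HasDerivAt g (fderiv ℝ f (x + t • v) v) t :=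
    (hcont.eventually hdiff).mono fun t ht => ht.hasFDerivAt.comp_hasDerivAt t (hline t)
  have hd1' : deriv g =ᶠ[𝓝 0] fun t => fderiv ℝ f (x + t • v) v := hd1.mono fun t ht => ht.deriv
  have hff : DifferentiableAt ℝ (fderiv ℝ f) x :=
    (hf.fderiv_right (m := 1) (by norm_num)).differentiableAt (by norm_num)
  have hd2 : HasDerivAt (deriv g) (fderiv ℝ (fderiv ℝ f) x v v) 0 := by
    refine HasDerivAt.congr_of_eventuallyEq ?_ hd1'
    have h := hff.hasFDerivAt
    have h0 : x = x + (0 : ℝ) • v := by simp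
    rw [h0] at h
    have h4 := h.comp_hasDerivAt (0 : ℝ) (hline 0)
    rw [← h0] at h4
    simpa using h4.clm_apply (hasDerivAt_const (0 : ℝ) v)
  have hgmin : IsLocalMin g 0 := by
    have := hcont.eventually hmin
    filter_upwards [this] with t ht
    simpa [hg] using ht
  by_contra! hneg
  have hg0 : deriv g 0 = 0 := hgmin.deriv_eq_zero
  have hgc : ContinuousAt g 0 := hd1.self_of_nhds.continuousAt
  -- A negative second derivative would make 0 a local maximum as well, so `g` would be locally
  -- constant and its second derivative zero.
  have hgmax : IsLocalMax g 0 :=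
    isLocalMax_of_deriv_deriv_neg (by rw [hd2.deriv]; exact hneg) hg0 hgc
  have hconst : g =ᶠ[𝓝 0] fun _ => g 0 := by
    filter_upwards [hgmin, hgmax] with t h1 h2 using le_antisymm h2 h1
  have h2 : deriv (deriv g) 0 = 0 := by
    have : deriv g =ᶠ[𝓝 0] deriv fun _ => g 0 := hconst.deriv
    rw [this.deriv_eq]; simp
  rw [hd2.deriv] at h2
  exact hneg.ne h2

/-! ### Hessians, Laplacians and determinants. -/

section Calculus

variable {E : Type*} [NormedAddCommGroup E] [InnerProductSpace ℝ E] [FiniteDimensional ℝ E]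

theorem laplacian_eq_sum_fderiv_fderiv {ι : Type*} [Fintype ι] (b : OrthonormalBasis ι ℝ E)
    (f : E → ℝ) (x : E) :
    Laplacian.laplacian f x = ∑ i, fderiv ℝ (fderiv ℝ f) x (b i) (b i) := by
  rw [InnerProductSpace.laplacian_eq_iteratedFDeriv_orthonormalBasis f b]
  simp [iteratedFDeriv_two_apply]

theorem ContDiffOn.laplacian {f : E → ℝ} {s : Set E} (hs : IsOpen s) {k : ℕ}
    (hf : ContDiffOn ℝ ((k + 2 : ℕ) : WithTop ℕ∞) f s) :
    ContDiffOn ℝ (k : WithTop ℕ∞) (Laplacian.laplacian f) s := by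
  have h1 : ContDiffOn ℝ ((k + 1 : ℕ) : WithTop ℕ∞) (fderiv ℝ f) s :=
    hf.fderiv_of_isOpen hs (by norm_cast)
  have h2 : ContDiffOn ℝ (k : WithTop ℕ∞) (fderiv ℝ (fderiv ℝ f)) s :=
    h1.fderiv_of_isOpen hs (by norm_cast)
  have h3 : Laplacian.laplacian f = fun x =>
      ∑ i, fderiv ℝ (fderiv ℝ f) x (stdOrthonormalBasis ℝ E i) (stdOrthonormalBasis ℝ E i) :=
    funext fun x => laplacian_eq_sum_fderiv_fderiv _ f x
  rw [h3]
  exact ContDiffOn.sum fun i _ => (h2.clm_apply contDiffOn_const).clm_apply contDiffOn_const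

/-- The eigenvalues are nonnegative, so each is at most their sum. This is cruder than the
arithmetic-geometric mean inequality, but the constant plays no role later. -/
theorem LinearMap.IsSymmetric.abs_det_le_trace_pow {T : E →ₗ[ℝ] E} (hT : T.IsSymmetric)
    (hpos : ∀ v, 0 ≤ inner ℝ (T v) v) :
    |LinearMap.det T| ≤ (LinearMap.trace ℝ E T) ^ Module.finrank ℝ E := by
  have hev : ∀ i, 0 ≤ hT.eigenvalues rfl i := fun i => by
    have h := hpos (hT.eigenvectorBasis rfl i)
    rw [hT.apply_eigenvectorBasis rfl i] at h
    simpa [inner_smul_left] using h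
  have hdet := hT.det_eq_prod_eigenvalues rfl
  have htr := hT.trace_eq_sum_eigenvalues rfl
  simp only [RCLike.ofReal_real_eq_id, id_eq] at hdet htr
  rw [hdet, htr, abs_of_nonneg (Finset.prod_nonneg fun i _ => hev i)]
  calc ∏ i, hT.eigenvalues rfl i ≤ ∏ _i : Fin (Module.finrank ℝ E), ∑ j, hT.eigenvalues rfl j :=
        Finset.prod_le_prod (fun i _ => hev i) fun i _ =>
          Finset.single_le_sum (f := fun j => hT.eigenvalues rfl j) (fun j _ => hev j)
            (Finset.mem_univ i)
    _ = _ := by simp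

/-- The determinant of a positive semidefinite Hessian is at most a power of the Laplacian. -/
theorem abs_det_hessian_le {f : E → ℝ} {x : E} (hf : ContDiffAt ℝ 2 f x)
    (hpos : ∀ v, 0 ≤ fderiv ℝ (fderiv ℝ f) x v v) :
    |((InnerProductSpace.toDual ℝ E).symm.toContinuousLinearEquiv.toContinuousLinearMap ∘L
      fderiv ℝ (fderiv ℝ f) x).det| ≤ (Laplacian.laplacian f x) ^ Module.finrank ℝ E := by
  set A : E →L[ℝ] E :=
    (InnerProductSpace.toDual ℝ E).symm.toContinuousLinearEquiv.toContinuousLinearMap ∘L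
      fderiv ℝ (fderiv ℝ f) x with hA
  have hin : ∀ v w, inner ℝ (A v) w = fderiv ℝ (fderiv ℝ f) x v w := fun v w => by
    simp [hA]
  have hsymm : (A : E →ₗ[ℝ] E).IsSymmetric := fun v w => by
    have := (hf.isSymmSndFDerivAt (by simp)).eq v w
    change inner ℝ (A v) w = inner ℝ v (A w)
    rw [real_inner_comm (A w) v, hin, hin, this]
  have h := hsymm.abs_det_le_trace_pow fun v => (hin v v).symm ▸ hpos v
  have htr : LinearMap.trace ℝ E (A : E →ₗ[ℝ] E) = Laplacian.laplacian f x := by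
    rw [LinearMap.trace_eq_sum_inner _ (stdOrthonormalBasis ℝ E),
      laplacian_eq_sum_fderiv_fderiv (stdOrthonormalBasis ℝ E)]
    refine Finset.sum_congr rfl fun i _ => ?_
    rw [← hin, real_inner_comm]; rfl
  rw [htr] at h
  exact h

end Calculus

/-! ### The Aleksandrov–Bakelman–Pucci estimate. -/

section ABP

open MeasureTheory

variable {E : Type*} [NormedAddCommGroup E] [InnerProductSpace ℝ E] [FiniteDimensional ℝ E]

/-- A function that dips to `-M` inside `D` while being almost nonnegative near the frontier has
every covector of norm less than `M / d` as its derivative at a negative convex contact point. -/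
theorem exists_contact_point {D : Set E} {w : E → ℝ} {d M : ℝ} (hD : IsOpen D)
    (hdiam : ∀ x ∈ D, ∀ y ∈ D, dist x y ≤ d) (hw : ContDiffOn ℝ 2 w D)
    (hbd : ∀ y ∈ frontier D, ∀ ε > 0, ∀ᶠ x in 𝓝[D] y, -ε < w x)
    {x₀ : E} (hx₀ : x₀ ∈ D) (hM : w x₀ = -M) {p : E} (hp : ‖p‖ * d < M) :
    ∃ x ∈ D, w x < 0 ∧ (∀ v, 0 ≤ fderiv ℝ (fderiv ℝ w) x v v) ∧
      fderiv ℝ w x = InnerProductSpace.toDual ℝ E p := by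
  set h : E → ℝ := fun x => w x - InnerProductSpace.toDual ℝ E p (x - x₀) with hh
  have hlin : ∀ x ∈ D, |InnerProductSpace.toDual ℝ E p (x - x₀)| ≤ ‖p‖ * d := fun x hx => by
    rw [InnerProductSpace.toDual_apply_apply]
    refine (abs_real_inner_le_norm _ _).trans ?_
    rw [← dist_eq_norm]
    gcongr
    exact hdiam x hx x₀ hx₀
  have hhc : ContDiffOn ℝ 2 h D := by
    refine hw.sub (ContDiff.contDiffOn ?_)
    exact (InnerProductSpace.toDual ℝ E p).contDiff.comp (contDiff_id.sub contDiff_const)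
  have hcont := hhc.continuousOn
  set S : Set E := {x | x ∈ D ∧ h x ≤ -M} with hS
  have hSD : S ⊆ D := fun x hx => hx.1
  have hx₀S : x₀ ∈ S := ⟨hx₀, by simp [hh, hM]⟩
  have hSclosed : IsClosed S := by
    refine isClosed_of_closure_subset fun y hy => ?_
    have hfreq : ∃ᶠ x in 𝓝 y, x ∈ S := mem_closure_iff_frequently.1 hy
    by_cases hyD : y ∈ D
    · refine ⟨hyD, ?_⟩
      by_contra! hlt
      have := (hcont.continuousAt (hD.mem_nhds hyD)).eventually (lt_mem_nhds hlt)
      obtain ⟨x, hx1, hx2⟩ := (hfreq.and_eventually this).exists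
      exact absurd hx1.2 (not_le.2 hx2)
    -- Near the frontier `w > -(M - ‖p‖ d)` while the linear term is at most `‖p‖ d`, so `h > -M`
    -- there: the sublevel set cannot reach the frontier.
    · have hyf : y ∈ frontier D := ⟨closure_mono hSD hy, by rwa [hD.interior_eq]⟩
      have h1 := eventually_nhdsWithin_iff.1 (hbd y hyf (M - ‖p‖ * d) (by linarith))
      obtain ⟨x, hx1, hx2⟩ := (hfreq.and_eventually h1).exists
      have h2 := hx2 hx1.1
      have h3 := (abs_le.1 (hlin x hx1.1)).2
      have h4 := hx1.2
      simp only [hh] at h4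
      linarith
  have hSc : IsCompact S := by
    refine Metric.isCompact_of_isClosed_isBounded hSclosed ?_
    exact Metric.isBounded_iff.2 ⟨d, fun x hx y hy => hdiam x hx.1 y hy.1⟩
  obtain ⟨x, hxS, hxmin⟩ := hSc.exists_isMinOn ⟨x₀, hx₀S⟩ (hcont.mono hSD)
  have hxD : x ∈ D := hxS.1
  have hloc : IsLocalMin h x := by
    filter_upwards [hD.mem_nhds hxD] with y hy
    by_cases hyS : y ∈ S
    · exact hxmin hyS
    · have : -M < h y := by
        by_contra! hle
        exact hyS ⟨hy, hle⟩
      exact hxS.2.trans this.le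
  have hfd : ∀ y ∈ D, fderiv ℝ h y = fderiv ℝ w y - InnerProductSpace.toDual ℝ E p := by
    intro y hy
    have h1 : DifferentiableAt ℝ w y :=
      (hw.contDiffAt (hD.mem_nhds hy)).differentiableAt (by norm_num)
    have h2 : HasFDerivAt (fun x => InnerProductSpace.toDual ℝ E p (x - x₀))
        (InnerProductSpace.toDual ℝ E p) y :=
      (InnerProductSpace.toDual ℝ E p).hasFDerivAt.comp y ((hasFDerivAt_id y).sub_const x₀)
    exact (h1.hasFDerivAt.sub h2).fderiv
  refine ⟨x, hxD, ?_, ?_, ?_⟩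
  · have h2 := hxS.2
    have h3 := (abs_le.1 (hlin x hxD)).2
    simp only [hh] at h2
    linarith
  · intro v
    have h1 := hloc.fderiv_fderiv_nonneg (hhc.contDiffAt (hD.mem_nhds hxD)) v
    have h2 : fderiv ℝ h =ᶠ[𝓝 x] fun y => fderiv ℝ w y - InnerProductSpace.toDual ℝ E p :=
      eventually_of_mem (hD.mem_nhds hxD) hfd
    rw [h2.fderiv_eq, fderiv_sub_const] at h1
    exact h1
  · have h1 := hloc.fderiv_eq_zero
    rw [hfd x hxD, sub_eq_zero] at h1
    exact h1

variable [MeasurableSpace E] [BorelSpace E]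

/-- The Aleksandrov–Bakelman–Pucci estimate for functions whose Laplacian is, where they are
negative, at most `K` on `A` and nonpositive off `A`. -/
theorem abp_estimate [Nontrivial E] {D A : Set E} {w : E → ℝ} {d θ K : ℝ} (hD : IsOpen D)
    (hd : 0 < d) (hdiam : ∀ x ∈ D, ∀ y ∈ D, dist x y ≤ d) (hw : ContDiffOn ℝ 2 w D)
    (hbd : ∀ y ∈ frontier D, ∀ ε > 0, ∀ᶠ x in 𝓝[D] y, -ε < w x)
    (hK : 0 ≤ K) (hθ : 0 ≤ θ)
    (hA : volume A ≤ ENNReal.ofReal (θ ^ Module.finrank ℝ E) * volume (Metric.ball (0 : E) 1))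
    (hlap : ∀ x ∈ D, w x < 0 → Laplacian.laplacian w x ≤ K)
    (hlapA : ∀ x ∈ D, x ∉ A → w x < 0 → Laplacian.laplacian w x ≤ 0) :
    ∀ x ∈ D, -(d * θ * K) ≤ w x := by
  intro x₀ hx₀
  by_contra! hlt
  obtain ⟨M, hM⟩ : ∃ M, w x₀ = -M := ⟨-w x₀, by ring⟩
  have hMd : θ * K < M / d := by
    rw [lt_div_iff₀ hd]; nlinarith
  have hMpos : 0 < M / d := (mul_nonneg hθ hK).trans_lt hMd
  set N := Module.finrank ℝ E with hN
  have hNpos : N ≠ 0 := Module.finrank_pos.ne'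
  set Γ : Set E := {x | x ∈ D ∧ w x < 0 ∧ ∀ v, 0 ≤ fderiv ℝ (fderiv ℝ w) x v v} with hΓ
  set G : E → E := fun x => (InnerProductSpace.toDual ℝ E).symm (fderiv ℝ w x) with hG
  have hfw : ContDiffOn ℝ 1 (fderiv ℝ w) D := hw.fderiv_of_isOpen hD (by norm_num)
  have hffw : ContinuousOn (fderiv ℝ (fderiv ℝ w)) D := hfw.continuousOn_fderiv_of_isOpen hD le_rfl
  have hΓm : MeasurableSet Γ := by
    have h1 : MeasurableSet (D ∩ w ⁻¹' Iio 0) :=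
      (hw.continuousOn.isOpen_inter_preimage hD isOpen_Iio).measurableSet
    have h2 : MeasurableSet
        (D ∩ fderiv ℝ (fderiv ℝ w) ⁻¹' {B | ∀ v, 0 ≤ B v v}) := by
      have hc : IsClosed {B : E →L[ℝ] E →L[ℝ] ℝ | ∀ v, 0 ≤ B v v} := by
        rw [ofPred_forall]
        refine isClosed_iInter fun v => isClosed_le continuous_const ?_
        fun_prop
      obtain ⟨C, hC, hCe⟩ := continuousOn_iff_isClosed.1 hffw _ hc
      rw [inter_comm, hCe]
      exact hC.measurableSet.inter hD.measurableSet
    convert h1.inter h2 using 1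
    ext x
    simp only [hΓ, mem_ofPred_eq, mem_inter_iff, mem_preimage, mem_Iio]
    tauto
  have hder : ∀ x ∈ Γ, HasFDerivWithinAt G
      ((InnerProductSpace.toDual ℝ E).symm.toContinuousLinearEquiv.toContinuousLinearMap ∘L
        fderiv ℝ (fderiv ℝ w) x) Γ x := fun x hx => by
    have h1 : HasFDerivAt (fderiv ℝ w) (fderiv ℝ (fderiv ℝ w) x) x :=
      ((hfw.contDiffAt (hD.mem_nhds hx.1)).differentiableAt (by norm_num)).hasFDerivAt
    exact ((InnerProductSpace.toDual ℝ E).symm.toContinuousLinearEquiv.toContinuousLinearMap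
      |>.hasFDerivAt.comp x h1).hasFDerivWithinAt
  -- The gradient map sends the contact set onto at least a ball of radius `M / d`; the area formula
  -- turns this into a bound on `M` by the Hessian determinant.
  have hsub : Metric.ball (0 : E) (M / d) ⊆ G '' Γ := fun p hp => by
    rw [mem_ball_zero_iff, lt_div_iff₀ hd] at hp
    obtain ⟨x, hxD, hx1, hx2, hx3⟩ := exists_contact_point hD hdiam hw hbd hx₀ hM hp
    exact ⟨x, ⟨hxD, hx1, hx2⟩, by simp [hG, hx3]⟩
  have hdet : ∀ x ∈ Γ, ENNReal.ofReal
      |((InnerProductSpace.toDual ℝ E).symm.toContinuousLinearEquiv.toContinuousLinearMap ∘L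
        fderiv ℝ (fderiv ℝ w) x).det| ≤ A.indicator (fun _ => ENNReal.ofReal (K ^ N)) x := by
    intro x hx
    have hcx := hw.contDiffAt (hD.mem_nhds hx.1)
    have h1 := abs_det_hessian_le hcx hx.2.2
    have h0 : 0 ≤ Laplacian.laplacian w x := by
      rw [laplacian_eq_sum_fderiv_fderiv (stdOrthonormalBasis ℝ E)]
      exact Finset.sum_nonneg fun i _ => hx.2.2 _
    by_cases hxA : x ∈ A
    · rw [indicator_of_mem hxA]
      exact ENNReal.ofReal_le_ofReal
        (h1.trans (pow_le_pow_left₀ h0 (hlap x hx.1 hx.2.1) _))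
    · rw [indicator_of_notMem hxA]
      -- Off `A` the Laplacian at a contact point has both signs, so the determinant vanishes and
      -- only `A` contributes volume.
      have h2 : Laplacian.laplacian w x = 0 := le_antisymm (hlapA x hx.1 hxA hx.2.1) h0
      rw [h2, zero_pow hNpos] at h1
      rw [le_antisymm h1 (abs_nonneg _), ENNReal.ofReal_zero]
  have hvol : volume (Metric.ball (0 : E) (M / d)) ≤ ENNReal.ofReal (K ^ N) * volume A :=
    calc volume (Metric.ball (0 : E) (M / d)) ≤ volume (G '' Γ) := measure_mono hsub
      _ ≤ ∫⁻ x in Γ, ENNReal.ofReal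
        |((InnerProductSpace.toDual ℝ E).symm.toContinuousLinearEquiv.toContinuousLinearMap ∘L
          fderiv ℝ (fderiv ℝ w) x).det| := addHaar_image_le_lintegral_abs_det_fderiv _ hΓm hder
      _ ≤ ∫⁻ x in Γ, A.indicator (fun _ => ENNReal.ofReal (K ^ N)) x :=
        setLIntegral_mono' hΓm hdet
      _ ≤ ∫⁻ x, A.indicator (fun _ => ENNReal.ofReal (K ^ N)) x := setLIntegral_le_lintegral _ _
      _ ≤ _ := lintegral_indicator_const_le _ _
  rw [Measure.addHaar_ball _ _ hMpos.le] at hvol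
  have hb0 : volume (Metric.ball (0 : E) 1) ≠ 0 :=
    (Metric.measure_ball_pos volume 0 one_pos).ne'
  have hbt : volume (Metric.ball (0 : E) 1) ≠ ⊤ := measure_ball_lt_top.ne
  have h3 : ENNReal.ofReal ((M / d) ^ N) * volume (Metric.ball (0 : E) 1) ≤
      ENNReal.ofReal ((θ * K) ^ N) * volume (Metric.ball (0 : E) 1) := by
    refine hvol.trans ((mul_le_mul_right hA _).trans_eq ?_)
    rw [← mul_assoc, ← ENNReal.ofReal_mul (by positivity), mul_pow, mul_comm (K ^ N)]
  rw [ENNReal.mul_le_mul_iff_left hb0 hbt,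
    ENNReal.ofReal_le_ofReal_iff (by positivity)] at h3
  exact absurd h3 (not_le.2 (pow_lt_pow_left₀ hMd (by positivity) hNpos))

end ABP

/-! ### Laplacians of radial functions. -/

section Radial

variable {E : Type*} [NormedAddCommGroup E] [InnerProductSpace ℝ E]

theorem hasFDerivAt_norm_sub_sq (x z : E) :
    HasFDerivAt (fun y : E => ‖y - z‖ ^ 2) ((2 : ℝ) • innerSL ℝ (x - z)) x := by
  have h := ((hasStrictFDerivAt_norm_sq (x - z)).hasFDerivAt).comp x
    ((hasFDerivAt_id x).sub_const z)
  exact h.congr_fderiv (by ext v; simp)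

/-- With `s = ‖y - z‖²` this is `Δφ(s) = φ''|∇s|² + φ'Δs`, where `|∇s|² = 4s` and `Δs = 2N`. It
serves both the logarithmic barrier at a pole and the exponential barrier of Hopf's argument. -/
theorem laplacian_radial [FiniteDimensional ℝ E] {φ φ' : ℝ → ℝ} {φ'' : ℝ} {x z : E}
    (h1 : ∀ᶠ s in 𝓝 (‖x - z‖ ^ 2), HasDerivAt φ (φ' s) s)
    (h2 : HasDerivAt φ' φ'' (‖x - z‖ ^ 2)) :
    Laplacian.laplacian (fun y : E => φ (‖y - z‖ ^ 2)) x =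
      4 * φ'' * ‖x - z‖ ^ 2 + 2 * Module.finrank ℝ E * φ' (‖x - z‖ ^ 2) := by
  obtain ⟨I, hI⟩ : ∃ I : E →L[ℝ] E →L[ℝ] ℝ, I = (2 : ℝ) • innerSL ℝ := ⟨_, rfl⟩
  have hIv : ∀ v w, I v w = 2 * inner ℝ v w := fun v w => by
    rw [hI]; simp only [smul_apply, smul_eq_mul]; rfl
  have hsq : ∀ y, HasFDerivAt (fun y : E => ‖y - z‖ ^ 2) (I (y - z)) y := fun y =>
    (hasFDerivAt_norm_sub_sq y z).congr_fderiv (by ext v; rw [hIv]; rfl)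
  have hc : Tendsto (fun y : E => ‖y - z‖ ^ 2) (𝓝 x) (𝓝 (‖x - z‖ ^ 2)) := (hsq x).continuousAt
  have hd : fderiv ℝ (fun y : E => φ (‖y - z‖ ^ 2)) =ᶠ[𝓝 x]
      fun y => φ' (‖y - z‖ ^ 2) • I (y - z) := by
    filter_upwards [hc.eventually h1] with y hy
    exact (hy.comp_hasFDerivAt y (hsq y)).fderiv
  have hin : HasFDerivAt (fun y : E => I (y - z)) I x :=
    I.hasFDerivAt.comp x ((hasFDerivAt_id x).sub_const z)
  have hdd : HasFDerivAt (fun y => φ' (‖y - z‖ ^ 2) • I (y - z))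
      (φ' (‖x - z‖ ^ 2) • I + (φ'' • I (x - z)).smulRight (I (x - z))) x :=
    (h2.comp_hasFDerivAt x (hsq x)).smul hin
  rw [laplacian_eq_sum_fderiv_fderiv (stdOrthonormalBasis ℝ E), hd.fderiv_eq, hdd.fderiv]
  have hsum : ∑ i, inner ℝ (x - z) (stdOrthonormalBasis ℝ E i) ^ 2 = ‖x - z‖ ^ 2 := by
    rw [← (stdOrthonormalBasis ℝ E).sum_sq_norm_inner_left (x - z)]
    simp
  have hterm : ∀ i, (φ' (‖x - z‖ ^ 2) • I + (φ'' • I (x - z)).smulRight (I (x - z)))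
      (stdOrthonormalBasis ℝ E i) (stdOrthonormalBasis ℝ E i) =
      2 * φ' (‖x - z‖ ^ 2) + 4 * φ'' * inner ℝ (x - z) (stdOrthonormalBasis ℝ E i) ^ 2 := by
    intro i
    have e : inner ℝ (stdOrthonormalBasis ℝ E i) (stdOrthonormalBasis ℝ E i) = (1 : ℝ) := by simp
    simp only [add_apply, smul_apply,
      ContinuousLinearMap.smulRight_apply, hIv, smul_eq_mul, e]
    ring
  rw [Finset.sum_congr rfl fun i _ => hterm i, Finset.sum_add_distrib,
    ← Finset.mul_sum (f := fun i => inner ℝ (x - z) (stdOrthonormalBasis ℝ E i) ^ 2), hsum]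
  simp
  ring

end Radial

/-! ### Maximum principles: removable pole, weak form, strong form. -/

section MaximumPrinciples

open MeasureTheory

variable {E : Type*} [NormedAddCommGroup E] [InnerProductSpace ℝ E] [FiniteDimensional ℝ E]
  [MeasurableSpace E] [BorelSpace E]

/-- The estimate `abp_estimate` on a domain with a puncture `z` at which the function is only
assumed to be bounded below. -/
theorem abp_estimate_of_pole (hdim : 2 ≤ Module.finrank ℝ E) {D A : Set E} {w : E → ℝ}
    {d θ K B : ℝ} {z : E} (hD : IsOpen D) (hz : z ∉ D) (hd : 0 < d)
    (hdiam : ∀ x ∈ D, ∀ y ∈ D, dist x y ≤ d) (hw : ContDiffOn ℝ 2 w D)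
    (hB : ∀ x ∈ D, -B ≤ w x)
    (hbd : ∀ y ∈ frontier D, y ≠ z → ∀ ε > 0, ∀ᶠ x in 𝓝[D] y, -ε < w x)
    (hK : 0 ≤ K) (hθ : 0 ≤ θ)
    (hA : volume A ≤ ENNReal.ofReal (θ ^ Module.finrank ℝ E) * volume (Metric.ball (0 : E) 1))
    (hlap : ∀ x ∈ D, w x < 0 → Laplacian.laplacian w x ≤ K)
    (hlapA : ∀ x ∈ D, x ∉ A → w x < 0 → Laplacian.laplacian w x ≤ 0) :
    ∀ x ∈ D, -(d * θ * K) ≤ w x := by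
  have : Nontrivial E := Module.nontrivial_of_finrank_pos (R := ℝ) (by omega)
  intro x₀ hx₀
  have hbound : ∀ x ∈ D, ‖x - z‖ ≤ d + ‖x₀ - z‖ := fun x hx => by
    have h1 := norm_sub_le_norm_sub_add_norm_sub x x₀ z
    have h2 := hdiam x hx x₀ hx₀
    rw [dist_eq_norm] at h2
    linarith
  -- `D` lies in the ball of radius `d + ‖x₀ - z‖` about `z`, so this constant makes the barrier
  -- nonnegative on `D`.
  set c : ℝ := Real.log ((d + ‖x₀ - z‖) ^ 2) with hc
  set g : E → ℝ := fun x => c - Real.log (‖x - z‖ ^ 2) with hg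
  have hpos : ∀ x ∈ D, 0 < ‖x - z‖ ^ 2 := fun x hx => by
    have : x - z ≠ 0 := sub_ne_zero.2 fun h => hz (h ▸ hx)
    positivity
  have hg0 : ∀ x ∈ D, 0 ≤ g x := fun x hx => by
    have := Real.log_le_log (hpos x hx) (pow_le_pow_left₀ (norm_nonneg _) (hbound x hx) 2)
    simp only [hg]; linarith
  have hgc : ContDiffOn ℝ 2 g D := by
    refine contDiffOn_const.sub (ContDiffOn.log ?_ fun x hx => (hpos x hx).ne')
    exact ((contDiff_id.sub contDiff_const).norm_sq ℝ).contDiffOn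
  -- The Laplacian equals `(4 - 2N) / ‖x - z‖²`; dimension at least two is exactly what makes it
  -- nonpositive.
  have hglap : ∀ x ∈ D, Laplacian.laplacian g x ≤ 0 := fun x hx => by
    have hs := hpos x hx
    have h := laplacian_radial (φ := fun s => c - Real.log s) (φ' := fun s => -s⁻¹)
      (φ'' := ((‖x - z‖ ^ 2) ^ 2)⁻¹) (x := x) (z := z)
      ((lt_mem_nhds hs).mono fun s hs => (Real.hasDerivAt_log hs.ne').const_sub c)
      ((hasDerivAt_inv hs.ne').neg.congr_deriv (neg_neg _))
    simp only [hg]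
    rw [h]
    have hdim' : (2 : ℝ) ≤ Module.finrank ℝ E := by exact_mod_cast hdim
    have e : 4 * ((‖x - z‖ ^ 2) ^ 2)⁻¹ * ‖x - z‖ ^ 2 = 4 * (‖x - z‖ ^ 2)⁻¹ := by
      field_simp
    rw [e]
    have : 0 < (‖x - z‖ ^ 2)⁻¹ := inv_pos.2 hs
    nlinarith
  have hgz : Tendsto g (𝓝[≠] z) atTop := by
    have h1 : Tendsto (fun x : E => ‖x - z‖ ^ 2) (𝓝[≠] z) (𝓝[≠] 0) := by
      refine tendsto_nhdsWithin_iff.2 ⟨?_, ?_⟩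
      · have h := (hasFDerivAt_norm_sub_sq z z).continuousAt.tendsto
        simp only [sub_self, norm_zero, ne_eq, OfNat.ofNat_ne_zero, not_false_eq_true,
          zero_pow] at h
        exact h.mono_left nhdsWithin_le_nhds
      · filter_upwards [self_mem_nhdsWithin] with x hx
        have : x - z ≠ 0 := sub_ne_zero.2 hx
        simpa using this
    have h2 := tendsto_neg_atBot_atTop.comp (Real.tendsto_log_nhdsNE_zero.comp h1)
    exact (tendsto_atTop_add_const_left _ c h2).congr fun x => by simp [hg, sub_eq_add_neg]
  -- However small `δ` is, `w + δ g` is nonnegative near the pole and has no larger Laplacian than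
  -- `w`, so the estimate without a pole applies; then `δ → 0`.
  have key : ∀ δ > 0, -(d * θ * K) ≤ w x₀ + δ * g x₀ := by
    intro δ hδ
    have hcd : ∀ x ∈ D, ContDiffAt ℝ 2 w x := fun x hx => hw.contDiffAt (hD.mem_nhds hx)
    have hgd : ∀ x ∈ D, ContDiffAt ℝ 2 g x := fun x hx => hgc.contDiffAt (hD.mem_nhds hx)
    have hle : ∀ x ∈ D, w x ≤ (w + δ • g) x := fun x hx => by
      have := mul_nonneg hδ.le (hg0 x hx)
      simp only [Pi.add_apply, Pi.smul_apply, smul_eq_mul]; linarith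
    have hlaple : ∀ x ∈ D, Laplacian.laplacian (w + δ • g) x ≤ Laplacian.laplacian w x := by
      intro x hx
      rw [(hcd x hx).laplacian_add (show ContDiffAt ℝ 2 (δ • g) x from (hgd x hx).const_smul δ),
        InnerProductSpace.laplacian_smul δ (hgd x hx)]
      have := mul_nonneg hδ.le (neg_nonneg.2 (hglap x hx))
      simp only [smul_eq_mul]; linarith
    refine abp_estimate (w := w + δ • g) hD hd hdiam (hw.add (hgc.const_smul δ)) ?_ hK hθ hA
      (fun x hx h => (hlaple x hx).trans (hlap x hx ((hle x hx).trans_lt h)))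
      (fun x hx hxA h => (hlaple x hx).trans (hlapA x hx hxA ((hle x hx).trans_lt h))) x₀ hx₀
    intro y hy ε hε
    by_cases hyz : y = z
    · subst hyz
      have hsub : 𝓝[D] y ≤ 𝓝[≠] y :=
        nhdsWithin_mono _ fun x hx h => hz (by rw [← (h : x = y)]; exact hx)
      filter_upwards [hsub (hgz.eventually_ge_atTop (B / δ)), self_mem_nhdsWithin] with x hx hxD
      have h1 := hB x hxD
      have h2 : B ≤ δ * g x := by
        rwa [div_le_iff₀' hδ] at hx
      simp only [Pi.add_apply, Pi.smul_apply, smul_eq_mul]; linarith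
    · filter_upwards [hbd y hy hyz ε hε, self_mem_nhdsWithin] with x hx hxD
      exact hx.trans_le (hle x hxD)
  have hlim : Tendsto (fun δ : ℝ => w x₀ + δ * g x₀) (𝓝[>] 0) (𝓝 (w x₀ + 0 * g x₀)) :=
    ((continuous_const.add (continuous_id.mul continuous_const)).tendsto 0).mono_left
      nhdsWithin_le_nhds
  have := ge_of_tendsto hlim (eventually_mem_nhdsWithin.mono fun δ hδ => key δ hδ)
  simpa using this

/-- The weak minimum principle. -/
theorem nonneg_of_laplacian_nonpos [Nontrivial E] {D : Set E} {w : E → ℝ} (hD : IsOpen D)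
    (hDb : Bornology.IsBounded D) (hw : ContDiffOn ℝ 2 w D)
    (hbd : ∀ y ∈ frontier D, ∀ ε > 0, ∀ᶠ x in 𝓝[D] y, -ε < w x)
    (hlap : ∀ x ∈ D, w x < 0 → Laplacian.laplacian w x ≤ 0) :
    ∀ x ∈ D, 0 ≤ w x := by
  intro x hx
  obtain ⟨C, hC⟩ := Metric.isBounded_iff.1 hDb
  have h := abp_estimate (A := ∅) (θ := 0) (K := 0) (d := max C 1) hD (by positivity)
    (fun x hx y hy => (hC hx hy).trans (le_max_left _ _)) hw hbd le_rfl le_rfl (by simp)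
    hlap (fun x hx _ => hlap x hx) x hx
  simpa using h

/-- The strong maximum principle: a nonnegative `w` with `Δ w ≤ a w` that vanishes at a point
vanishes near that point. -/
theorem eventually_eq_zero_of_laplacian_le [Nontrivial E] {D : Set E} {w : E → ℝ} {a : ℝ}
    (ha : 0 ≤ a) (hD : IsOpen D) (hw : ContDiffOn ℝ 2 w D) (hw0 : ∀ x ∈ D, 0 ≤ w x)
    (hlap : ∀ x ∈ D, Laplacian.laplacian w x ≤ a * w x) {x₀ : E} (hx₀ : x₀ ∈ D)
    (hwx₀ : w x₀ = 0) : ∀ᶠ x in 𝓝 x₀, w x = 0 := by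
  obtain ⟨ρ, hρ, hball⟩ := Metric.nhds_basis_closedBall.mem_iff.1 (hD.mem_nhds hx₀)
  filter_upwards [Metric.ball_mem_nhds x₀ (half_pos hρ)] with z hz
  by_contra hne
  rw [Metric.mem_ball] at hz
  set Z : Set E := Metric.closedBall x₀ ρ ∩ w ⁻¹' {0} with hZ
  have hcont := hw.continuousOn
  have hZc : IsCompact Z :=
    (isCompact_closedBall x₀ ρ).of_isClosed_subset
      ((hcont.mono hball).preimage_isClosed_of_isClosed Metric.isClosed_closedBall
        isClosed_singleton) inter_subset_left
  -- Hopf's configuration: `x₁` is a zero nearest to `z`, so `w > 0` in the ball about `z` that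
  -- touches `x₁`.
  obtain ⟨x₁, hx₁, hmin⟩ := hZc.exists_isMinOn
    ⟨x₀, Metric.mem_closedBall_self hρ.le, hwx₀⟩
    (f := fun x => dist x z) (by fun_prop)
  set R := dist x₁ z with hR
  have hRle : R ≤ dist x₀ z := hmin ⟨Metric.mem_closedBall_self hρ.le, hwx₀⟩
  rw [dist_comm x₀ z] at hRle
  have hRpos : 0 < R := dist_pos.2 fun h => hne (h ▸ hx₁.2)
  have hsub : ∀ y, dist y z ≤ R → y ∈ Metric.closedBall x₀ ρ := fun y hy => by
    have := dist_triangle y z x₀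
    rw [Metric.mem_closedBall]; linarith
  have hwpos : ∀ y, dist y z < R → 0 < w y := fun y hy => by
    refine lt_of_le_of_ne (hw0 y (hball (hsub y hy.le))) fun h => ?_
    exact absurd (hmin ⟨hsub y hy.le, h.symm⟩) (not_le.2 hy)
  have hx₁D : x₁ ∈ D := hball hx₁.1
  obtain ⟨N, hN⟩ : ∃ N : ℝ, N = (Module.finrank ℝ E : ℝ) := ⟨_, rfl⟩
  have hN0 : 0 ≤ N := hN ▸ Nat.cast_nonneg _
  -- On the annulus `4‖x - z‖² ≥ R²`, so `Δv ≥ a v` follows from `β (β R² - 2N) ≥ a`; this `β` makes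
  -- the bracket at least 1 and `β ≥ a`.
  set β : ℝ := a + (2 * N + 1) / R ^ 2 with hβ
  have hβpos : 0 < β := by positivity
  have hβa : a ≤ β := by
    have : 0 ≤ (2 * N + 1) / R ^ 2 := by positivity
    linarith
  have hβR : 2 * N + 1 ≤ β * R ^ 2 := by
    have : β * R ^ 2 = a * R ^ 2 + (2 * N + 1) := by rw [hβ]; field_simp
    nlinarith [mul_nonneg ha (sq_nonneg R)]
  set v : E → ℝ := fun x => Real.exp (-β * ‖x - z‖ ^ 2) - Real.exp (-β * R ^ 2) with hv
  have hvc : ContDiff ℝ 2 v := by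
    refine (ContDiff.exp ?_).sub contDiff_const
    exact contDiff_const.mul ((contDiff_id.sub contDiff_const).norm_sq ℝ)
  have hvlap : ∀ x, Laplacian.laplacian v x =
      (4 * β ^ 2 * ‖x - z‖ ^ 2 - 2 * N * β) * Real.exp (-β * ‖x - z‖ ^ 2) := fun x => by
    have hexp : ∀ s : ℝ, HasDerivAt (fun s => Real.exp (-β * s)) (-β * Real.exp (-β * s)) s :=
      fun s => by
        simpa [mul_comm] using ((hasDerivAt_id s).const_mul (-β)).exp
    have h := laplacian_radial (φ := fun s => Real.exp (-β * s) - Real.exp (-β * R ^ 2))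
      (φ' := fun s => -β * Real.exp (-β * s)) (x := x) (z := z)
      (Eventually.of_forall fun s => (hexp s).sub_const _) ((hexp _).const_mul (-β))
    simp only [hv]
    rw [h, hN]; ring
  set Ann : Set E := {x | R / 2 < dist x z} ∩ {x | dist x z < R} with hAnn
  have hAo : IsOpen Ann :=
    (isOpen_lt continuous_const (by fun_prop)).inter (isOpen_lt (by fun_prop) continuous_const)
  have hAcl : closure Ann ⊆ {x | R / 2 ≤ dist x z} ∩ {x | dist x z ≤ R} :=
    closure_minimal (inter_subset_inter (ofPred_subset_ofPred.2 fun _ => le_of_lt)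
        (ofPred_subset_ofPred.2 fun _ => le_of_lt))
      ((isClosed_le continuous_const (by fun_prop)).inter
        (isClosed_le (by fun_prop) continuous_const))
  have hAD : Ann ⊆ D := fun x hx => hball (hsub x (le_of_lt hx.2))
  have hAb : Bornology.IsBounded Ann :=
    Metric.isBounded_closedBall.subset fun x hx => hsub x (le_of_lt hx.2)
  obtain ⟨ε, hε, hεw⟩ : ∃ ε > 0, ∀ x, dist x z = R / 2 → ε ≤ w x := by
    have hS : IsCompact (Metric.sphere z (R / 2)) := isCompact_sphere z _
    have hSD : Metric.sphere z (R / 2) ⊆ D := fun x hx => by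
      rw [Metric.mem_sphere] at hx
      exact hball (hsub x (by linarith))
    rcases (Metric.sphere z (R / 2)).eq_empty_or_nonempty with he | hne
    · refine ⟨1, one_pos, fun x hx => ?_⟩
      have : x ∈ Metric.sphere z (R / 2) := hx
      simp [he] at this
    · obtain ⟨x, hx, hxm⟩ := hS.exists_isMinOn hne (hcont.mono hSD)
      refine ⟨w x, hwpos x ?_, fun y hy => hxm hy⟩
      rw [Metric.mem_sphere] at hx
      linarith
  have hq : ContDiffOn ℝ 2 (w - ε • v) D := hw.sub (hvc.contDiffOn.const_smul ε)
  have hwv : ∀ x ∈ Ann, 0 ≤ (w - ε • v) x := by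
    refine nonneg_of_laplacian_nonpos hAo hAb (hq.mono hAD) ?_ ?_
    · intro y hy η hη
      have hyc := hAcl hy.1
      have hyD : y ∈ D := hball (hsub y hyc.2)
      have hy0 : 0 ≤ (w - ε • v) y := by
        simp only [Pi.sub_apply, Pi.smul_apply, smul_eq_mul, hv, ← dist_eq_norm]
        rcases eq_or_lt_of_le (show R / 2 ≤ dist y z from hyc.1) with h | h
        · have h1 := hεw y h.symm
          have h2 : Real.exp (-β * dist y z ^ 2) ≤ 1 :=
            Real.exp_le_one_iff.2 (by nlinarith [sq_nonneg (dist y z)])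
          have h3 := (Real.exp_pos (-β * R ^ 2)).le
          nlinarith
        · have h1 : dist y z = R := by
            refine le_antisymm hyc.2 (not_lt.1 fun h' => ?_)
            exact hy.2 (by rw [hAo.interior_eq]; exact ⟨h, h'⟩)
          rw [h1]
          simpa using hw0 y hyD
      have hc := (hq.continuousOn.continuousAt (hD.mem_nhds hyD)).eventually
        (lt_mem_nhds (show -η < (w - ε • v) y by linarith))
      exact nhdsWithin_le_nhds hc
    -- The inequality is needed only where `w < ε v`: there `Δ(w - ε v) ≤ a (w - ε v) ≤ 0`, so the
    -- zero-order term helps.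
    · intro x hx hneg
      have hxD := hAD hx
      rw [(hw.contDiffAt (hD.mem_nhds hxD)).laplacian_sub
          (show ContDiffAt ℝ 2 (ε • v) x from hvc.contDiffAt.const_smul ε),
        InnerProductSpace.laplacian_smul ε hvc.contDiffAt, hvlap]
      have h1 := hlap x hxD
      simp only [Pi.sub_apply, Pi.smul_apply, smul_eq_mul] at hneg ⊢
      have h2 : a * v x ≤
          (4 * β ^ 2 * ‖x - z‖ ^ 2 - 2 * N * β) * Real.exp (-β * ‖x - z‖ ^ 2) := by
        have hs : R ^ 2 ≤ 4 * ‖x - z‖ ^ 2 := by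
          have : R / 2 < dist x z := hx.1
          rw [dist_eq_norm] at this
          nlinarith
        have h3 : v x ≤ Real.exp (-β * ‖x - z‖ ^ 2) := by
          have := (Real.exp_pos (-β * R ^ 2)).le
          simp only [hv]; linarith
        have h4 : a ≤ 4 * β ^ 2 * ‖x - z‖ ^ 2 - 2 * N * β := by
          have : β ^ 2 * R ^ 2 ≤ β ^ 2 * (4 * ‖x - z‖ ^ 2) := by gcongr
          nlinarith
        exact (mul_le_mul_of_nonneg_left h3 ha).trans
          (mul_le_mul_of_nonneg_right h4 (Real.exp_pos _).le)
      have h5 := mul_le_mul_of_nonneg_left h2 hε.le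
      nlinarith [mul_nonneg ha (sub_nonneg.2 hneg.le)]
  have hnx₁ : ‖x₁ - z‖ = R := by rw [← dist_eq_norm]
  have hwmin : IsLocalMin w x₁ := by
    filter_upwards [hD.mem_nhds hx₁D] with y hy
    rw [show w x₁ = 0 from hx₁.2]
    exact hw0 y hy
  have hwd : HasFDerivAt w (0 : E →L[ℝ] ℝ) x₁ := by
    rw [← hwmin.fderiv_eq_zero]
    exact ((hw.contDiffAt (hD.mem_nhds hx₁D)).differentiableAt (by norm_num)).hasFDerivAt
  have hline : HasDerivAt (fun t : ℝ => x₁ + t • (z - x₁)) (z - x₁) 0 := by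
    simpa using ((hasDerivAt_id (0 : ℝ)).smul_const (z - x₁)).const_add x₁
  have hk1 : HasDerivAt (fun t : ℝ => w (x₁ + t • (z - x₁))) 0 0 := by
    have h0 : x₁ = x₁ + (0 : ℝ) • (z - x₁) := by simp
    rw [h0] at hwd
    have := hwd.comp_hasDerivAt (0 : ℝ) hline
    exact this.congr_deriv (by simp)
  have hk2 : HasDerivAt (fun t : ℝ => Real.exp (-β * ((1 - t) * R) ^ 2) - Real.exp (-β * R ^ 2))
      (2 * β * R ^ 2 * Real.exp (-β * R ^ 2)) 0 := by
    have h1 : HasDerivAt (fun t : ℝ => -β * ((1 - t) * R) ^ 2) (2 * β * R ^ 2) 0 := by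
      have h := (((((hasDerivAt_id (0 : ℝ)).const_sub 1).mul_const R).pow 2).const_mul (-β))
      refine h.congr_deriv ?_
      simp; ring
    have h2 := h1.exp.sub_const (Real.exp (-β * R ^ 2))
    refine h2.congr_deriv ?_
    simp; ring
  -- Along the segment from `x₁` to `z`, `w` has zero slope at its interior minimum while `ε v` has
  -- positive slope; yet `w - ε v` vanishes at `x₁` and is nonnegative just inside.
  have hk := (hk1.sub (hk2.const_mul ε)).tendsto_slope_zero_right
  have hge : 0 ≤ 0 - ε * (2 * β * R ^ 2 * Real.exp (-β * R ^ 2)) := by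
    refine ge_of_tendsto hk ?_
    filter_upwards [Ioo_mem_nhdsGT (show (0 : ℝ) < 1 / 2 by norm_num)] with t ht
    have hdist : ‖x₁ + t • (z - x₁) - z‖ = (1 - t) * R := by
      have : x₁ + t • (z - x₁) - z = (1 - t) • (x₁ - z) := by
        module
      rw [this, norm_smul, hnx₁, Real.norm_of_nonneg (by linarith [ht.2])]
    have hmem : x₁ + t • (z - x₁) ∈ Ann := by
      refine ⟨?_, ?_⟩ <;> rw [mem_ofPred_eq, dist_eq_norm, hdist] <;> nlinarith [ht.1, ht.2]
    have h1 := hwv _ hmem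
    simp only [Pi.sub_apply, Pi.smul_apply, smul_eq_mul, hv, hdist] at h1
    have h2 : w x₁ = 0 := hx₁.2
    simp only [zero_add, Pi.sub_apply, zero_smul, add_zero, sub_zero, one_mul, sub_self, mul_zero,
      smul_eq_mul, h2]
    exact mul_nonneg (inv_nonneg.2 ht.1.le) h1
  have : 0 < ε * (2 * β * R ^ 2 * Real.exp (-β * R ^ 2)) := by positivity
  linarith

end MaximumPrinciples

/-! ### Invariance of the Laplacian under isometries. -/

section LaplacianIsometry

variable {E : Type*} [NormedAddCommGroup E] [InnerProductSpace ℝ E] [FiniteDimensional ℝ E]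

/-- The Laplacian is a trace, so it may be computed at the image point in the orthonormal basis
transported by `L`. -/
theorem laplacian_comp_isometry_add (L : E ≃ₗᵢ[ℝ] E) (c : E) {f : E → ℝ} {x : E}
    (hf : ContDiffAt ℝ 2 f (L x + c)) :
    Laplacian.laplacian (fun y => f (L y + c)) x = Laplacian.laplacian f (L x + c) := by
  set ℓ : E →L[ℝ] E := L.toContinuousLinearEquiv.toContinuousLinearMap with hℓ
  have hℓv : ∀ v, ℓ v = L v := fun v => rfl
  have hT : ∀ y, HasFDerivAt (fun y => L y + c) ℓ y := fun y => ℓ.hasFDerivAt.add_const c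
  have hd : fderiv ℝ (fun y => f (L y + c)) =ᶠ[𝓝 x] fun y => (fderiv ℝ f (L y + c)).comp ℓ := by
    filter_upwards [(hT x).continuousAt.eventually (hf.eventually (by simp))] with y hy
    exact ((hy.differentiableAt (by norm_num)).hasFDerivAt.comp y (hT y)).fderiv
  have hff : DifferentiableAt ℝ (fderiv ℝ f) (L x + c) :=
    (hf.fderiv_right (m := 1) (by norm_num)).differentiableAt (by norm_num)
  have hdd : HasFDerivAt (fun y => (fderiv ℝ f (L y + c)).comp ℓ) _ x :=
    (hff.hasFDerivAt.comp x (hT x)).clm_comp (hasFDerivAt_const ℓ x)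
  rw [laplacian_eq_sum_fderiv_fderiv (stdOrthonormalBasis ℝ E),
    laplacian_eq_sum_fderiv_fderiv ((stdOrthonormalBasis ℝ E).map L), hd.fderiv_eq, hdd.fderiv]
  refine Finset.sum_congr rfl fun i _ => ?_
  simp [hℓv]

end LaplacianIsometry

/-! ### Reflections and caps. -/

section Reflection

variable {n : ℕ} [NeZero n]

/-- Reflection across the hyperplane `{x₁ = c}`. -/
noncomputable def reflectAt (c : ℝ) (x : EuclideanSpace ℝ (Fin n)) : EuclideanSpace ℝ (Fin n) :=
  WithLp.toLp 2 (fun j => if j = 0 then 2 * c - x j else x j)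

@[simp] theorem reflectAt_apply_zero (c : ℝ) (x : EuclideanSpace ℝ (Fin n)) :
    reflectAt c x 0 = 2 * c - x 0 := by simp [reflectAt]

theorem reflectAt_apply_of_ne (c : ℝ) (x : EuclideanSpace ℝ (Fin n)) {j : Fin n} (hj : j ≠ 0) :
    reflectAt c x j = x j := by simp [reflectAt, hj]

theorem reflectAt_zero : (reflectAt 0 : EuclideanSpace ℝ (Fin n) → _) = reflectX1 := by
  funext x
  simp [reflectAt, reflectX1]

@[simp] theorem reflectAt_reflectAt (c : ℝ) (x : EuclideanSpace ℝ (Fin n)) :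
    reflectAt c (reflectAt c x) = x := by
  ext j
  by_cases hj : j = 0
  · subst hj; simp
  · simp [reflectAt_apply_of_ne, hj]

/-- The linear part of `reflectAt c`. -/
noncomputable def reflectX1Isometry : EuclideanSpace ℝ (Fin n) ≃ₗᵢ[ℝ] EuclideanSpace ℝ (Fin n) :=
  LinearIsometryEquiv.piLpCongrRight 2 fun j : Fin n =>
    if j = 0 then LinearIsometryEquiv.neg ℝ else LinearIsometryEquiv.refl ℝ ℝ

theorem reflectAt_eq (c : ℝ) (x : EuclideanSpace ℝ (Fin n)) :
    reflectAt c x = reflectX1Isometry x + reflectAt c 0 := by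
  ext j
  by_cases hj : j = 0
  · subst hj; simp [reflectX1Isometry]; ring
  · simp [reflectX1Isometry, reflectAt_apply_of_ne, hj]

theorem contDiff_reflectAt (c : ℝ) {k : WithTop ℕ∞} :
    ContDiff ℝ k (reflectAt c : EuclideanSpace ℝ (Fin n) → _) := by
  rw [show (reflectAt c : EuclideanSpace ℝ (Fin n) → _) =
    fun x => reflectX1Isometry x + reflectAt c 0 from funext (reflectAt_eq c)]
  exact reflectX1Isometry.toContinuousLinearEquiv.contDiff.add contDiff_const

theorem continuous_reflectAt_uncurry :
    Continuous fun p : ℝ × EuclideanSpace ℝ (Fin n) => reflectAt p.1 p.2 := by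
  refine (PiLp.continuous_toLp 2 _).comp (continuous_pi fun j => ?_)
  by_cases hj : j = 0
  · simp only [hj, if_true]; fun_prop
  · simp only [hj, if_false]; fun_prop

theorem continuous_reflectAt (c : ℝ) :
    Continuous (reflectAt c : EuclideanSpace ℝ (Fin n) → _) :=
  (contDiff_reflectAt c (k := 0)).continuous

theorem laplacian_comp_reflectAt (c : ℝ) {f : EuclideanSpace ℝ (Fin n) → ℝ}
    {x : EuclideanSpace ℝ (Fin n)} (hf : ContDiffAt ℝ 2 f (reflectAt c x)) :
    Laplacian.laplacian (fun y => f (reflectAt c y)) x = Laplacian.laplacian f (reflectAt c x) := by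
  rw [reflectAt_eq c x] at hf ⊢
  rw [show (fun y => f (reflectAt c y)) = fun y => f (reflectX1Isometry y + reflectAt c 0) from
    funext fun y => by rw [reflectAt_eq c y]]
  exact laplacian_comp_isometry_add _ _ hf

theorem reflectAt_of_apply_zero_eq {c : ℝ} {x : EuclideanSpace ℝ (Fin n)} (hx : x 0 = c) :
    reflectAt c x = x := by
  ext j
  by_cases hj : j = 0
  · subst hj; simp [hx]; ring
  · simp [reflectAt_apply_of_ne, hj]

/-- The part of `Ω` to the right of `{x₁ = c}`, without the mirror image of the origin. -/
def puncturedCap (Ω : Set (EuclideanSpace ℝ (Fin n))) (c : ℝ) : Set (EuclideanSpace ℝ (Fin n)) :=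
  Ω ∩ ({x | c < x 0} ∩ {x | reflectAt c x ≠ 0})

variable {Ω : Set (EuclideanSpace ℝ (Fin n))} {c : ℝ} {x y : EuclideanSpace ℝ (Fin n)}

theorem isOpen_puncturedCap (hΩ : IsOpen Ω) : IsOpen (puncturedCap Ω c) :=
  hΩ.inter ((isOpen_lt continuous_const (by fun_prop)).inter
    (isOpen_ne_fun (continuous_reflectAt c) continuous_const))

/-- The point `y` lies on the segment joining `x` to its mirror image in `{x₁ = 0}`. -/
theorem IsSymmetricX1Domain.mem_of_abs_le (hΩ : IsSymmetricX1Domain Ω) (hx : x ∈ Ω)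
    (h : ∀ j, j ≠ 0 → y j = x j) (h0 : |y 0| ≤ x 0) : y ∈ Ω := by
  rcases eq_or_lt_of_le ((abs_nonneg (y 0)).trans h0) with hx0 | hx0
  · have hy0 : y 0 = 0 := abs_eq_zero.1 (le_antisymm (h0.trans hx0.symm.le) (abs_nonneg _))
    have : y = x := by
      ext j
      by_cases hj : j = 0
      · subst hj; rw [hy0, ← hx0]
      · exact h j hj
    rwa [this]
  · have h1 := (abs_le.1 h0).1
    have h2 := (abs_le.1 h0).2
    have hr := hΩ.symmetric x hx
    rw [← reflectAt_zero] at hr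
    have hmem := hΩ.convexX1 x hx _ hr (fun j hj => (reflectAt_apply_of_ne 0 x hj).symm)
      ((x 0 - y 0) / (2 * x 0))
      ⟨div_nonneg (by linarith) (by linarith), (div_le_one (by linarith)).2 (by linarith)⟩
    convert hmem using 1
    ext j
    by_cases hj : j = 0
    · subst hj; simp; field_simp; ring
    · simp [reflectAt_apply_of_ne, hj, h j hj]; ring

theorem IsSymmetricX1Domain.reflectAt_mem (hΩ : IsSymmetricX1Domain Ω) (hc : 0 ≤ c) (hx : x ∈ Ω)
    (hcx : c ≤ x 0) : reflectAt c x ∈ Ω := by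
  refine hΩ.mem_of_abs_le hx (fun j hj => reflectAt_apply_of_ne c x hj) ?_
  rw [reflectAt_apply_zero, abs_le]
  constructor <;> linarith

theorem ne_zero_of_apply_zero_pos (hx : 0 < x 0) : x ≠ 0 := by
  rintro rfl
  simp at hx

theorem puncturedCap_subset (hc : 0 ≤ c) : puncturedCap Ω c ⊆ Ω \ {0} := fun _ hx =>
  ⟨hx.1, ne_zero_of_apply_zero_pos (hc.trans_lt hx.2.1)⟩

theorem IsSymmetricX1Domain.reflectAt_mem_of_mem_puncturedCap (hΩ : IsSymmetricX1Domain Ω)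
    (hc : 0 ≤ c) (hx : x ∈ puncturedCap Ω c) : reflectAt c x ∈ Ω \ {0} :=
  ⟨hΩ.reflectAt_mem hc hx.1 (le_of_lt hx.2.1), hx.2.2⟩

theorem mem_frontier_puncturedCap (hΩ : IsOpen Ω) (hy : y ∈ frontier (puncturedCap Ω c))
    (hne : y ≠ reflectAt c 0) : y ∈ frontier Ω ∨ (y ∈ Ω ∧ y 0 = c) := by
  have hyD : y ∉ puncturedCap Ω c := by
    have := hy.2
    rwa [(isOpen_puncturedCap hΩ).interior_eq] at this
  have h1 : y ∈ closure Ω := closure_mono inter_subset_left hy.1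
  have h2 : c ≤ y 0 := by
    have hcl : IsClosed {x : EuclideanSpace ℝ (Fin n) | c ≤ x 0} :=
      isClosed_le continuous_const (by fun_prop)
    exact closure_minimal (fun x hx => le_of_lt (show c < x 0 from hx.2.1)) hcl hy.1
  by_cases hyΩ : y ∈ Ω
  · refine Or.inr ⟨hyΩ, (eq_or_lt_of_le h2).elim Eq.symm fun h3 => ?_⟩
    refine absurd ⟨hyΩ, h3, fun h4 => hne ?_⟩ hyD
    rw [← h4, reflectAt_reflectAt]
  · exact Or.inl ⟨h1, by rwa [hΩ.interior_eq]⟩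

end Reflection

/-! ### The cooperative system and its reflected differences on caps. -/

section System

open MeasureTheory

variable {n : ℕ} [NeZero n]

/-- A chain `-Δ Uᵢ + aᵢ Uᵢ = Uᵢ₊₁` (`i < m`) closed by `U_m = f(U₀)` on `Ω ∖ {0}`, with zero boundary
values, bounded below, and with positive first component. -/
structure IsCooperativeSystem (m : ℕ) (a : ℕ → ℝ) (f : ℝ → ℝ) (Ω : Set (EuclideanSpace ℝ (Fin n)))
    (U : ℕ → EuclideanSpace ℝ (Fin n) → ℝ) : Prop where
  coeff_nonneg : ∀ i < m, 0 ≤ a i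
  contDiffOn : ∀ i < m, ContDiffOn ℝ 2 (U i) (Ω \ {0})
  laplacian_eq : ∀ i < m, ∀ x ∈ Ω \ {0}, Laplacian.laplacian (U i) x = a i * U i x - U (i + 1) x
  last_eq : ∀ x ∈ Ω \ {0}, U m x = f (U 0 x)
  pos : ∀ x ∈ Ω \ {0}, 0 < U 0 x
  tendsto_frontier : ∀ i < m, ∀ y ∈ frontier Ω, Tendsto (U i) (𝓝[Ω \ {0}] y) (𝓝 0)
  bddBelow : ∀ i < m, BddBelow (U i '' (Ω \ {0}))

/-- The increment of `u` under reflection across `{x₁ = c}`. -/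
noncomputable def reflectDiff (c : ℝ) (u : EuclideanSpace ℝ (Fin n) → ℝ) :
    EuclideanSpace ℝ (Fin n) → ℝ := fun x => u (reflectAt c x) - u x

theorem IsSymmetricX1Domain.isOpen_diff {Ω : Set (EuclideanSpace ℝ (Fin n))}
    (hΩ : IsSymmetricX1Domain Ω) : IsOpen (Ω \ {0}) :=
  hΩ.isOpen.sdiff isClosed_singleton

theorem IsSymmetricX1Domain.exists_diam {Ω : Set (EuclideanSpace ℝ (Fin n))}
    (hΩ : IsSymmetricX1Domain Ω) : ∃ d > 0, ∀ x ∈ Ω, ∀ y ∈ Ω, dist x y ≤ d := by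
  obtain ⟨C, hC⟩ := Metric.isBounded_iff.1 hΩ.isBounded
  exact ⟨max C 1, by positivity, fun x hx y hy => (hC hx hy).trans (le_max_left _ _)⟩

variable {m : ℕ} {a : ℕ → ℝ} {f : ℝ → ℝ} {Ω : Set (EuclideanSpace ℝ (Fin n))}
  {U : ℕ → EuclideanSpace ℝ (Fin n) → ℝ} {c : ℝ}

/-- Downward induction from `f(u) ≥ f(0) ≥ 0`: once the next component is nonnegative, the current
one is superharmonic wherever it is negative, and the pole at the origin is harmless because of the
lower bound. -/
theorem IsCooperativeSystem.nonneg (hn : 2 ≤ n) (hΩ : IsSymmetricX1Domain Ω)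
    (hf : IsAdmissibleNonlinearity f) (hU : IsCooperativeSystem m a f Ω U) :
    ∀ i ≤ m, ∀ x ∈ Ω \ {0}, 0 ≤ U i x := by
  obtain ⟨d, hd, hdiam⟩ := hΩ.exists_diam
  intro i hi
  induction hi using Nat.decreasingInduction with
  | self =>
    intro x hx
    rw [hU.last_eq x hx]
    have h0 := (hU.pos x hx).le
    exact hf.zero_nonneg.trans (hf.monotone (mem_Ici.2 le_rfl) h0 h0)
  | of_succ i hi ih =>
    obtain ⟨B, hB⟩ := hU.bddBelow i hi
    have key := abp_estimate_of_pole (w := U i) (D := Ω \ {0}) (A := ∅) (d := d) (θ := 0) (K := 0)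
      (B := -B) (z := 0) (by simpa using hn) hΩ.isOpen_diff (fun h => h.2 rfl) hd
      (fun x hx y hy => hdiam x hx.1 y hy.1) (hU.contDiffOn i hi)
      (fun x hx => by rw [neg_neg]; exact hB (mem_image_of_mem _ hx))
      ?_ le_rfl le_rfl (by simp) ?_ ?_
    · simpa using key
    · intro y hy hy0 ε hε
      have hyf : y ∈ frontier Ω := by
        refine ⟨closure_mono sdiff_subset hy.1, fun h => ?_⟩
        rw [hΩ.isOpen.interior_eq] at h
        have := hy.2
        rw [hΩ.isOpen_diff.interior_eq] at this
        exact this ⟨h, hy0⟩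
      exact (hU.tendsto_frontier i hi y hyf).eventually (lt_mem_nhds (by linarith))
    all_goals
      intro x hx
      intros
      rw [hU.laplacian_eq i hi x hx]
      have := ih x hx
      have := hU.coeff_nonneg i hi
      nlinarith

/-- Away from the origin each component has a finite limit at every point of the compact closure of
the cap, hence is bounded. Together with nonnegativity this bounds the differences below near the
mirror image of the origin. -/
theorem IsCooperativeSystem.exists_le_of_lt_apply_zero (hΩ : IsSymmetricX1Domain Ω)
    (hU : IsCooperativeSystem m a f Ω U) {i : ℕ} (hi : i < m) (hc : 0 < c) :
    ∃ B, ∀ x ∈ Ω, c < x 0 → U i x ≤ B := by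
  have hcl : IsClosed {x : EuclideanSpace ℝ (Fin n) | c ≤ x 0} :=
    isClosed_le continuous_const (by fun_prop)
  have hK : IsCompact (closure Ω ∩ {x : EuclideanSpace ℝ (Fin n) | c ≤ x 0}) :=
    (hΩ.isBounded.isCompact_closure).inter_right hcl
  have key : ∃ B, ∀ x ∈ closure Ω ∩ {x : EuclideanSpace ℝ (Fin n) | c ≤ x 0},
      x ∈ Ω \ {0} → U i x ≤ B := by
    refine hK.induction_on (p := fun s => ∃ B, ∀ x ∈ s, x ∈ Ω \ {0} → U i x ≤ B) ⟨0, by simp⟩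
      (fun s t hst ⟨B, hB⟩ => ⟨B, fun x hx => hB x (hst hx)⟩) ?_ ?_
    · rintro s t ⟨B, hB⟩ ⟨B', hB'⟩
      refine ⟨max B B', fun x hx hxΩ => ?_⟩
      exact hx.elim (fun h => (hB x h hxΩ).trans (le_max_left _ _))
        fun h => (hB' x h hxΩ).trans (le_max_right _ _)
    · intro y hy
      obtain ⟨l, hl⟩ : ∃ l, Tendsto (U i) (𝓝[Ω \ {0}] y) (𝓝 l) := by
        by_cases hyΩ : y ∈ Ω
        · have hy0 : y ∈ Ω \ {0} := ⟨hyΩ, ne_zero_of_apply_zero_pos (hc.trans_le hy.2)⟩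
          exact ⟨U i y, (hU.contDiffOn i hi).continuousOn y hy0⟩
        · exact ⟨0, hU.tendsto_frontier i hi y ⟨hy.1, by rwa [hΩ.isOpen.interior_eq]⟩⟩
      have h := eventually_nhdsWithin_iff.1 (hl.eventually (gt_mem_nhds (lt_add_one l)))
      exact ⟨_, mem_nhdsWithin_of_mem_nhds h, l + 1, fun x hx hxΩ => (hx hxΩ).le⟩
  obtain ⟨B, hB⟩ := key
  exact ⟨B, fun x hx hcx => hB x ⟨subset_closure hx, hcx.le⟩
    ⟨hx, ne_zero_of_apply_zero_pos (hc.trans hcx)⟩⟩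

theorem IsCooperativeSystem.contDiffOn_reflectDiff (hΩ : IsSymmetricX1Domain Ω)
    (hU : IsCooperativeSystem m a f Ω U) {i : ℕ} (hi : i < m) (hc : 0 < c) :
    ContDiffOn ℝ 2 (reflectDiff c (U i)) (puncturedCap Ω c) :=
  ((hU.contDiffOn i hi).comp (contDiff_reflectAt c).contDiffOn fun _ hx =>
    hΩ.reflectAt_mem_of_mem_puncturedCap hc.le hx).sub
    ((hU.contDiffOn i hi).mono (puncturedCap_subset hc.le))

theorem IsCooperativeSystem.laplacian_reflectDiff (hΩ : IsSymmetricX1Domain Ω)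
    (hU : IsCooperativeSystem m a f Ω U) {i : ℕ} (hi : i < m) (hc : 0 < c) :
    ∀ x ∈ puncturedCap Ω c, Laplacian.laplacian (reflectDiff c (U i)) x =
      a i * reflectDiff c (U i) x - reflectDiff c (U (i + 1)) x := by
  intro x hx
  have h1 := hΩ.reflectAt_mem_of_mem_puncturedCap hc.le hx
  have h2 := puncturedCap_subset hc.le hx
  have hc1 := (hU.contDiffOn i hi).contDiffAt (hΩ.isOpen_diff.mem_nhds h1)
  have hc2 := (hU.contDiffOn i hi).contDiffAt (hΩ.isOpen_diff.mem_nhds h2)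
  have h3 := ContDiffAt.laplacian_sub
    (show ContDiffAt ℝ 2 (fun y => U i (reflectAt c y)) x from
      hc1.comp x (contDiff_reflectAt c).contDiffAt) hc2
  rw [laplacian_comp_reflectAt c hc1, hU.laplacian_eq i hi _ h1, hU.laplacian_eq i hi _ h2] at h3
  refine Eq.trans h3 ?_
  simp only [reflectDiff]
  ring

/-- On the frontier of `Ω` the subtracted value tends to 0 and the reflected one is nonnegative; on
the plane the difference is continuous and vanishes. -/
theorem IsCooperativeSystem.reflectDiff_frontier (hn : 2 ≤ n) (hΩ : IsSymmetricX1Domain Ω)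
    (hf : IsAdmissibleNonlinearity f)
    (hU : IsCooperativeSystem m a f Ω U) {i : ℕ} (hi : i < m) (hc : 0 < c) :
    ∀ y ∈ frontier (puncturedCap Ω c), y ≠ reflectAt c 0 → ∀ ε > 0,
      ∀ᶠ x in 𝓝[puncturedCap Ω c] y, -ε < reflectDiff c (U i) x := by
  intro y hy hne ε hε
  rcases mem_frontier_puncturedCap hΩ.isOpen hy hne with h | ⟨h, hyc⟩
  · have h1 := ((hU.tendsto_frontier i hi y h).mono_left
      (nhdsWithin_mono y (puncturedCap_subset hc.le))).eventually (gt_mem_nhds hε)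
    filter_upwards [h1, self_mem_nhdsWithin] with x hx hxD
    have := hU.nonneg hn hΩ hf i hi.le _ (hΩ.reflectAt_mem_of_mem_puncturedCap hc.le hxD)
    simp only [reflectDiff]
    linarith
  · have hy0 : y ∈ Ω \ {0} := ⟨h, ne_zero_of_apply_zero_pos (hyc.symm ▸ hc)⟩
    have hcy := (hU.contDiffOn i hi).continuousOn.continuousAt (hΩ.isOpen_diff.mem_nhds hy0)
    have hr := reflectAt_of_apply_zero_eq hyc
    have hcw : ContinuousAt (reflectDiff c (U i)) y := by
      refine ContinuousAt.sub (ContinuousAt.comp ?_ (continuous_reflectAt c).continuousAt) hcy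
      rwa [hr]
    have h0 : reflectDiff c (U i) y = 0 := by simp [reflectDiff, hr]
    exact nhdsWithin_le_nhds (hcw.eventually (lt_mem_nhds (by rw [h0]; linarith)))

/-- A lower bound for the next component that is only needed on a small set gives a small lower
bound for the current one. -/
theorem IsCooperativeSystem.le_reflectDiff (hn : 2 ≤ n) (hΩ : IsSymmetricX1Domain Ω)
    (hf : IsAdmissibleNonlinearity f) (hU : IsCooperativeSystem m a f Ω U) {i : ℕ} (hi : i < m)
    (hc : 0 < c) {d θ B : ℝ} {A : Set (EuclideanSpace ℝ (Fin n))} (hd : 0 < d)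
    (hdiam : ∀ x ∈ Ω, ∀ y ∈ Ω, dist x y ≤ d) (hθ : 0 ≤ θ)
    (hA : volume A ≤
      ENNReal.ofReal (θ ^ n) * volume (Metric.ball (0 : EuclideanSpace ℝ (Fin n)) 1))
    (hB : 0 ≤ B) (hle : ∀ x ∈ puncturedCap Ω c, -B ≤ reflectDiff c (U (i + 1)) x)
    (hleA : ∀ x ∈ puncturedCap Ω c, x ∉ A → 0 ≤ reflectDiff c (U (i + 1)) x) :
    ∀ x ∈ puncturedCap Ω c, -(d * θ * B) ≤ reflectDiff c (U i) x := by
  obtain ⟨C, hC⟩ := hU.exists_le_of_lt_apply_zero hΩ hi hc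
  refine abp_estimate_of_pole (A := A) (B := C) (z := reflectAt c 0) (by simpa using hn)
    (isOpen_puncturedCap hΩ.isOpen) (fun h => h.2.2 (reflectAt_reflectAt c 0)) hd
    (fun x hx y hy => hdiam x hx.1 y hy.1) (hU.contDiffOn_reflectDiff hΩ hi hc) ?_
    (hU.reflectDiff_frontier hn hΩ hf hi hc) hB hθ (by simpa using hA) ?_ ?_
  · intro x hx
    have h1 := hU.nonneg hn hΩ hf i hi.le _ (hΩ.reflectAt_mem_of_mem_puncturedCap hc.le hx)
    have h2 := hC x hx.1 hx.2.1
    simp only [reflectDiff]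
    linarith
  · intro x hx hneg
    rw [hU.laplacian_reflectDiff hΩ hi hc x hx]
    have := hle x hx
    have := hU.coeff_nonneg i hi
    nlinarith
  · intro x hx hxA hneg
    rw [hU.laplacian_reflectDiff hΩ hi hc x hx]
    have := hleA x hx hxA
    have := hU.coeff_nonneg i hi
    nlinarith

theorem IsCooperativeSystem.reflectDiff_last_nonneg (hΩ : IsSymmetricX1Domain Ω)
    (hf : IsAdmissibleNonlinearity f) (hU : IsCooperativeSystem m a f Ω U) (hc : 0 < c)
    {x : EuclideanSpace ℝ (Fin n)} (hx : x ∈ puncturedCap Ω c)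
    (h : 0 ≤ reflectDiff c (U 0) x) : 0 ≤ reflectDiff c (U m) x := by
  have h1 := hΩ.reflectAt_mem_of_mem_puncturedCap hc.le hx
  have h2 := puncturedCap_subset hc.le hx
  simp only [reflectDiff] at h ⊢
  rw [hU.last_eq _ h1, hU.last_eq _ h2]
  have := hf.monotone (mem_Ici.2 (hU.pos _ h2).le) (mem_Ici.2 (hU.pos _ h1).le) (by linarith)
  linarith

/-- Monotonicity of `f` disposes of points where the first difference is nonnegative; elsewhere the
Lipschitz bound applies. -/
theorem IsCooperativeSystem.le_reflectDiff_last (hΩ : IsSymmetricX1Domain Ω)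
    (hf : IsAdmissibleNonlinearity f) {L : NNReal} (hL : LipschitzOnWith L f (Ici 0))
    (hU : IsCooperativeSystem m a f Ω U) (hc : 0 < c)
    {x : EuclideanSpace ℝ (Fin n)} (hx : x ∈ puncturedCap Ω c) {B : ℝ} (hB : 0 ≤ B)
    (h : -B ≤ reflectDiff c (U 0) x) : -(L * B) ≤ reflectDiff c (U m) x := by
  rcases le_total 0 (reflectDiff c (U 0) x) with h0 | h0
  · have := hU.reflectDiff_last_nonneg hΩ hf hc hx h0
    have : 0 ≤ L * B := by positivity
    linarith
  have h1 := hΩ.reflectAt_mem_of_mem_puncturedCap hc.le hx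
  have h2 := puncturedCap_subset hc.le hx
  simp only [reflectDiff] at h h0 ⊢
  rw [hU.last_eq _ h1, hU.last_eq _ h2]
  have h3 := hL.dist_le_mul _ (mem_Ici.2 (hU.pos _ h1).le) _ (mem_Ici.2 (hU.pos _ h2).le)
  rw [Real.dist_eq, Real.dist_eq, abs_of_nonpos h0] at h3
  have h4 := (abs_le.1 h3).1
  have : L * -(U 0 (reflectAt c x) - U 0 x) ≤ L * B :=
    mul_le_mul_of_nonneg_left (by linarith) L.2
  linarith

/-- The maximum principle for the differences on caps where the first one is nonnegative off a set
of small measure. The constants depend only on the domain, the Lipschitz constant and `m`. -/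
theorem IsCooperativeSystem.exists_small (hn : 2 ≤ n) (hm : 1 ≤ m) (hΩ : IsSymmetricX1Domain Ω)
    (hf : IsAdmissibleNonlinearity f) (hU : IsCooperativeSystem m a f Ω U) :
    ∃ η : ENNReal, 0 < η ∧ ∀ c > 0, ∀ A : Set (EuclideanSpace ℝ (Fin n)), volume A ≤ η →
      (∀ x ∈ puncturedCap Ω c, x ∉ A → 0 ≤ reflectDiff c (U 0) x) →
      ∀ i < m, ∀ x ∈ puncturedCap Ω c, 0 ≤ reflectDiff c (U i) x := by
  obtain ⟨d, hd, hdiam⟩ := hΩ.exists_diam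
  obtain ⟨L, hL⟩ := hf.lipschitz
  set b := volume (Metric.ball (0 : EuclideanSpace ℝ (Fin n)) 1) with hb
  have hb0 : 0 < b := Metric.measure_ball_pos volume 0 one_pos
  have hbt : b ≠ ⊤ := measure_ball_lt_top.ne
  have hn0 : n ≠ 0 := by omega
  obtain ⟨Θ, hΘ, hΩΘ⟩ : ∃ Θ : ℝ, 0 ≤ Θ ∧ volume Ω ≤ ENNReal.ofReal (Θ ^ n) * b := by
    have hsub : Ω ⊆ Metric.closedBall 0 d := fun x hx => hdiam x hx 0 hΩ.zero_mem
    refine ⟨d, hd.le, (measure_mono hsub).trans_eq ?_⟩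
    rw [Measure.addHaar_closedBall _ _ hd.le]
    simp [hb]
  set C := d * Θ with hC
  have hC0 : 0 ≤ C := by positivity
  -- One circuit costs `C` for each of the `m - 1` upper links and `d θ L` for the closing link
  -- through `f`. The added 1 keeps the denominator positive when `L = 0`.
  obtain ⟨θ, hθ, hθle⟩ : ∃ θ : ℝ, 0 < θ ∧ C ^ (m - 1) * (d * θ * L) ≤ 1 / 2 := by
    refine ⟨1 / (2 * (C ^ (m - 1) * d * L + 1)), by positivity, ?_⟩
    have h : 0 ≤ C ^ (m - 1) * d * L := by positivity
    have e : C ^ (m - 1) * (d * (1 / (2 * (C ^ (m - 1) * d * L + 1))) * L) =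
      (C ^ (m - 1) * d * L) / (2 * (C ^ (m - 1) * d * L + 1)) := by ring
    rw [e, div_le_div_iff₀ (by positivity) two_pos]
    linarith
  refine ⟨ENNReal.ofReal (θ ^ n) * b,
    ENNReal.mul_pos (ENNReal.ofReal_pos.2 (by positivity)).ne' hb0.ne', ?_⟩
  intro c hc A hA hA0
  -- In these links nothing is known about where the next difference is negative, so the exceptional
  -- set is all of `Ω`. Only the closing link, in `halve`, exploits the smallness of `A`.
  have chain : ∀ B ≥ 0, (∀ x ∈ puncturedCap Ω c, -B ≤ reflectDiff c (U (m - 1)) x) →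
      ∀ k ≤ m - 1, ∀ x ∈ puncturedCap Ω c, -(C ^ k * B) ≤ reflectDiff c (U (m - 1 - k)) x := by
    intro B hB h0 k
    induction k with
    | zero => intro _; simpa using h0
    | succ k ih =>
      intro hk
      have e : m - 1 - (k + 1) + 1 = m - 1 - k := by omega
      have h := hU.le_reflectDiff hn hΩ hf (i := m - 1 - (k + 1)) (by omega) hc hd hdiam hΘ
        hΩΘ (B := C ^ k * B) (by positivity)
        (by rw [e]; exact ih (by omega))
        (fun x hx hxΩ => absurd hx.1 hxΩ)
      intro x hx
      have := h x hx
      rw [← hC] at this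
      rwa [pow_succ', mul_assoc]
  have halve : ∀ B ≥ 0, (∀ x ∈ puncturedCap Ω c, -B ≤ reflectDiff c (U 0) x) →
      (∀ x ∈ puncturedCap Ω c, -(d * θ * (L * B)) ≤ reflectDiff c (U (m - 1)) x) := by
    intro B hB h0
    have e : m - 1 + 1 = m := by omega
    refine hU.le_reflectDiff hn hΩ hf (i := m - 1) (by omega) hc hd hdiam hθ.le hA
      (by positivity) ?_ ?_
    · rw [e]
      exact fun x hx => hU.le_reflectDiff_last hΩ hf hL hc hx hB (h0 x hx)
    · rw [e]
      exact fun x hx hxA => hU.reflectDiff_last_nonneg hΩ hf hc hx (hA0 x hx hxA)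
  obtain ⟨B, hB, hB0⟩ : ∃ B ≥ 0, ∀ x ∈ puncturedCap Ω c, -B ≤ reflectDiff c (U 0) x := by
    obtain ⟨B, hB⟩ := hU.exists_le_of_lt_apply_zero hΩ (i := 0) (by omega) hc
    refine ⟨max B 0, le_max_right _ _, fun x hx => ?_⟩
    have h1 := hU.pos _ (hΩ.reflectAt_mem_of_mem_puncturedCap hc.le hx)
    have h2 := (hB x hx.1 hx.2.1).trans (le_max_left B 0)
    simp only [reflectDiff]
    linarith
  have hiter : ∀ k : ℕ, ∀ x ∈ puncturedCap Ω c, -(B * (1 / 2) ^ k) ≤ reflectDiff c (U 0) x := by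
    intro k
    induction k with
    | zero => simpa using hB0
    | succ k ih =>
      intro x hx
      have hBk : 0 ≤ B * (1 / 2) ^ k := by positivity
      have h1 := chain _ (by positivity) (halve _ hBk ih) (m - 1) le_rfl x hx
      rw [Nat.sub_self] at h1
      have h2 := mul_le_mul_of_nonneg_right hθle hBk
      rw [pow_succ]
      linarith
  have hzero : ∀ x ∈ puncturedCap Ω c, 0 ≤ reflectDiff c (U 0) x := by
    intro x hx
    have hlim : Tendsto (fun k : ℕ => -(B * (1 / 2 : ℝ) ^ k)) atTop (𝓝 (-(B * 0))) :=
      ((tendsto_pow_atTop_nhds_zero_of_lt_one (by norm_num) (by norm_num)).const_mul B).neg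
    have := le_of_tendsto hlim (Eventually.of_forall fun k => hiter k x hx)
    simpa using this
  -- With the first difference nonnegative, a final pass with `B = 0` carries nonnegativity to all
  -- the others.
  have hlast := halve 0 le_rfl (by simpa using hzero)
  intro i hi x hx
  have h := chain 0 le_rfl (by simpa using hlast) (m - 1 - i) (by omega) x hx
  rw [show m - 1 - (m - 1 - i) = i by omega] at h
  simpa using h

end System

/-! ### Moving the plane, then symmetry and monotonicity. -/

section MovingPlanes

open MeasureTheory

variable {n : ℕ} [NeZero n] {m : ℕ} {a : ℕ → ℝ} {f : ℝ → ℝ} {Ω : Set (EuclideanSpace ℝ (Fin n))}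
  {U : ℕ → EuclideanSpace ℝ (Fin n) → ℝ} {c : ℝ}

/-- The cap need not be connected, so a zero is followed along a line in the `x₁`-direction. By the
strong maximum principle it can stop only on the frontier of `Ω`, where `U 0` tends to 0 while its
value at the reflected point, interior to `Ω`, is positive. Off the axis the line avoids the mirror
image of the origin. -/
theorem IsCooperativeSystem.reflectDiff_pos (hn : 2 ≤ n) (hm : 1 ≤ m) (hΩ : IsSymmetricX1Domain Ω)
    (hf : IsAdmissibleNonlinearity f) (hU : IsCooperativeSystem m a f Ω U) (hc : 0 < c)
    (h : ∀ i < m, ∀ x ∈ puncturedCap Ω c, 0 ≤ reflectDiff c (U i) x) :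
    ∀ x ∈ puncturedCap Ω c, 0 < reflectDiff c (U 0) x := by
  have : Nontrivial (EuclideanSpace ℝ (Fin n)) :=
    Module.nontrivial_of_finrank_pos (R := ℝ) (by simp; omega)
  have hD := isOpen_puncturedCap hΩ.isOpen (c := c)
  have hcd := hU.contDiffOn_reflectDiff hΩ (i := 0) hm hc
  have h1 : ∀ x ∈ puncturedCap Ω c, 0 ≤ reflectDiff c (U 1) x := fun x hx => by
    rcases hm.eq_or_lt with rfl | hm
    · exact hU.reflectDiff_last_nonneg hΩ hf hc hx (h 0 one_pos x hx)
    · exact h 1 hm x hx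
  have hopen : ∀ x ∈ puncturedCap Ω c, reflectDiff c (U 0) x = 0 →
      ∀ᶠ y in 𝓝 x, reflectDiff c (U 0) y = 0 := fun x hx hx0 => by
    refine eventually_eq_zero_of_laplacian_le (hU.coeff_nonneg 0 hm) hD hcd (h 0 hm) ?_ hx hx0
    intro y hy
    rw [hU.laplacian_reflectDiff hΩ hm hc y hy]
    have := h1 y hy
    simpa using this
  intro x hx
  refine lt_of_le_of_ne (h 0 hm x hx) fun hx0 => ?_
  -- move the zero off the axis
  set j : Fin n := ⟨1, hn⟩ with hj
  have hj0 : j ≠ 0 := fun h => by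
    have := congrArg Fin.val h
    simp [hj] at this
  obtain ⟨p, hp, hp0, hpj⟩ : ∃ p ∈ puncturedCap Ω c, reflectDiff c (U 0) p = 0 ∧ p j ≠ 0 := by
    by_cases hxj : x j = 0
    · have hcont : Tendsto (fun t : ℝ => x + t • EuclideanSpace.single j (1 : ℝ)) (𝓝[>] 0) (𝓝 x) := by
        have : Continuous fun t : ℝ => x + t • EuclideanSpace.single j (1 : ℝ) := by fun_prop
        simpa using (this.tendsto 0).mono_left (nhdsWithin_le_nhds (s := Ioi 0))
      obtain ⟨t, ht, ht1, ht2⟩ := (eventually_mem_nhdsWithin.and ((hcont.eventually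
        (hD.mem_nhds hx)).and (hcont.eventually (hopen x hx hx0.symm)))).exists
      exact ⟨_, ht1, ht2, by simpa [hxj] using (ne_of_gt ht)⟩
    · exact ⟨x, hx, hx0.symm, hxj⟩
  -- follow the ray from `p` to the right
  set γ : ℝ → EuclideanSpace ℝ (Fin n) := fun t => p + t • EuclideanSpace.single 0 (1 : ℝ) with hγ
  have hγc : Continuous γ := by fun_prop
  have hγ0 : ∀ t, γ t 0 = p 0 + t := fun t => by simp [hγ]
  have hγj : ∀ t i, i ≠ 0 → γ t i = p i := fun t i hi => by simp [hγ, hi]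
  have hoff : ∀ t, reflectAt c (γ t) ≠ 0 := fun t h0 => hpj <| by
    rw [← hγj t j hj0, ← reflectAt_apply_of_ne c _ hj0, h0]; rfl
  have hpc : c < p 0 := hp.2.1
  set S : Set ℝ := {t | 0 ≤ t ∧ γ t ∈ Ω ∧ reflectDiff c (U 0) (γ t) = 0} with hS
  have hSD : ∀ t, 0 ≤ t → γ t ∈ Ω → γ t ∈ puncturedCap Ω c := fun t ht hmem =>
    ⟨hmem, by rw [mem_ofPred_eq, hγ0]; linarith, hoff t⟩
  have h0S : (0 : ℝ) ∈ S := ⟨le_rfl, by simpa [hγ] using hp.1, by simpa [hγ] using hp0⟩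
  obtain ⟨d, hd, hdiam⟩ := hΩ.exists_diam
  have hSb : BddAbove S := by
    refine ⟨d, fun t ht => ?_⟩
    have := hdiam _ ht.2.1 _ hp.1
    rw [dist_eq_norm] at this
    simpa [hγ, norm_smul, abs_of_nonneg ht.1] using this
  set b := sSup S with hb
  have hbS : b ∈ closure S := csSup_mem_closure ⟨0, h0S⟩ hSb
  have hb0 : 0 ≤ b := le_csSup hSb h0S
  have : (𝓝[S] b).NeBot := mem_closure_iff_nhdsWithin_neBot.1 hbS
  have hγS : Tendsto γ (𝓝[S] b) (𝓝[Ω \ {0}] (γ b)) := by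
    refine tendsto_nhdsWithin_iff.2 ⟨hγc.continuousAt.tendsto.mono_left nhdsWithin_le_nhds, ?_⟩
    filter_upwards [self_mem_nhdsWithin] with t ht
    exact puncturedCap_subset hc.le (hSD t ht.1 ht.2.1)
  by_cases hbΩ : γ b ∈ Ω
  · have hbD := hSD b hb0 hbΩ
    have hcont : ContinuousAt (fun t => reflectDiff c (U 0) (γ t)) b :=
      ContinuousAt.comp (hcd.continuousOn.continuousAt (hD.mem_nhds hbD)) hγc.continuousAt
    have hb1 : reflectDiff c (U 0) (γ b) = 0 := by
      refine tendsto_nhds_unique (hcont.tendsto.mono_left nhdsWithin_le_nhds)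
        (tendsto_const_nhds.congr' ?_ : Tendsto _ (𝓝[S] b) _)
      filter_upwards [self_mem_nhdsWithin] with t ht using ht.2.2.symm
    have hev : ∀ᶠ t in 𝓝[>] b, t ∈ S := by
      have e1 := hγc.continuousAt.eventually (hopen _ hbD hb1)
      have e2 := hγc.continuousAt.eventually (hΩ.isOpen.mem_nhds hbΩ)
      filter_upwards [nhdsWithin_le_nhds e1, nhdsWithin_le_nhds e2, self_mem_nhdsWithin]
        with t h1 h2 h3
      exact ⟨hb0.trans (le_of_lt h3), h2, h1⟩
    obtain ⟨t, ht1, ht2⟩ := (hev.and self_mem_nhdsWithin).exists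
    exact absurd (le_csSup hSb ht1) (not_le.2 ht2)
  · have hfr : γ b ∈ frontier Ω := by
      refine ⟨?_, by rwa [hΩ.isOpen.interior_eq]⟩
      exact mem_closure_of_tendsto (hγc.continuousAt.tendsto.mono_left nhdsWithin_le_nhds)
        (eventually_mem_nhdsWithin.mono fun t ht => ht.2.1 : ∀ᶠ t in 𝓝[S] b, γ t ∈ Ω)
    have hlim0 : Tendsto (fun t => U 0 (γ t)) (𝓝[S] b) (𝓝 0) :=
      (hU.tendsto_frontier 0 hm _ hfr).comp hγS
    have hrefl : reflectAt c (γ b) ∈ Ω \ {0} := by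
      refine ⟨?_, hoff b⟩
      -- Strict because `0 < c < p 0 + b`; hence the reflected endpoint is already within reach of
      -- some `γ t ∈ Ω` with `t` near `b`.
      have hlt : |2 * c - (p 0 + b)| - p 0 < b := by
        rw [sub_lt_iff_lt_add, abs_lt]
        constructor <;> linarith
      obtain ⟨t, ht1, ht2⟩ := (((lt_mem_nhds hlt).filter_mono nhdsWithin_le_nhds).and
        (eventually_mem_nhdsWithin : ∀ᶠ t in 𝓝[S] b, t ∈ S)).exists
      refine hΩ.mem_of_abs_le ht2.2.1 (fun i hi => ?_) ?_
      · rw [reflectAt_apply_of_ne c _ hi, hγj _ _ hi, hγj _ _ hi]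
      · rw [reflectAt_apply_zero, hγ0, hγ0]; linarith
    have hlim1 : Tendsto (fun t => U 0 (reflectAt c (γ t))) (𝓝[S] b)
        (𝓝 (U 0 (reflectAt c (γ b)))) := by
      have hcU := (hU.contDiffOn 0 hm).continuousOn.continuousAt (hΩ.isOpen_diff.mem_nhds hrefl)
      exact hcU.tendsto.comp (((continuous_reflectAt c).comp hγc).continuousAt.tendsto.mono_left
        nhdsWithin_le_nhds)
    have heq : (fun t => U 0 (γ t)) =ᶠ[𝓝[S] b] fun t => U 0 (reflectAt c (γ t)) := by
      filter_upwards [self_mem_nhdsWithin] with t ht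
      exact (sub_eq_zero.1 ht.2.2).symm
    have := tendsto_nhds_unique (hlim0.congr' heq) hlim1
    exact absurd this (hU.pos _ hrefl).ne

theorem volume_setOf_apply_zero_eq (μ : ℝ) :
    volume {x : EuclideanSpace ℝ (Fin n) | x 0 = μ} = 0 := by
  have h0 : volume (LinearMap.ker (EuclideanSpace.proj (𝕜 := ℝ) (0 : Fin n) :
      EuclideanSpace ℝ (Fin n) →L[ℝ] ℝ).toLinearMap : Set (EuclideanSpace ℝ (Fin n))) = 0 := by
    refine Measure.addHaar_submodule _ _ fun h => ?_
    have : EuclideanSpace.single (0 : Fin n) (1 : ℝ) ∈ LinearMap.ker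
      (EuclideanSpace.proj (𝕜 := ℝ) (0 : Fin n) : EuclideanSpace ℝ (Fin n) →L[ℝ] ℝ).toLinearMap := by
      rw [h]; trivial
    simp at this
  rw [← measure_preimage_add_right volume (-EuclideanSpace.single (0 : Fin n) μ)] at h0
  convert h0 using 2
  ext x
  simp [← sub_eq_add_neg, sub_eq_zero]

/-- The slabs decrease to a subset of a hyperplane, which is null, inside a set of finite measure.
-/
theorem exists_volume_slab_lt (hΩ : IsSymmetricX1Domain Ω) (μ : ℝ) {η : ENNReal} (hη : 0 < η) :
    ∃ δ > 0, volume (Ω ∩ ({x | μ - δ < x 0} ∩ {x | x 0 ≤ μ})) < η := by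
  set T : ℕ → Set (EuclideanSpace ℝ (Fin n)) := fun k =>
    Ω ∩ ({x | μ - 1 / ((k : ℝ) + 1) < x 0} ∩ {x | x 0 ≤ μ}) with hT
  have hmeas : ∀ k, MeasurableSet (T k) := fun k => by
    refine hΩ.isOpen.measurableSet.inter (MeasurableSet.inter ?_ ?_)
    · exact (isOpen_lt continuous_const (by fun_prop)).measurableSet
    · exact (isClosed_le (by fun_prop) continuous_const).measurableSet
  have hanti : Antitone T := fun k l hkl x hx => by
    have hlt : μ - 1 / ((l : ℝ) + 1) < x 0 := hx.2.1
    refine ⟨hx.1, ?_, hx.2.2⟩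
    rw [mem_ofPred_eq]
    have := one_div_le_one_div_of_le (show (0 : ℝ) < k + 1 by positivity)
      (show (k : ℝ) + 1 ≤ l + 1 by gcongr)
    linarith
  have hlim := tendsto_measure_iInter_atTop (μ := volume)
    (fun k => (hmeas k).nullMeasurableSet) hanti
    ⟨0, ((measure_mono inter_subset_left).trans_lt hΩ.isBounded.measure_lt_top).ne⟩
  have hnull : volume (⋂ k, T k) = 0 := by
    refine measure_mono_null (fun x hx => ?_) (volume_setOf_apply_zero_eq μ)
    rw [mem_iInter] at hx
    refine le_antisymm (hx 0).2.2 (not_lt.1 fun hlt => ?_)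
    obtain ⟨k, hk⟩ := exists_nat_one_div_lt (sub_pos.2 hlt)
    have : μ - 1 / ((k : ℝ) + 1) < x 0 := (hx k).2.1
    linarith
  rw [hnull] at hlim
  obtain ⟨k, hk⟩ := (hlim.eventually (gt_mem_nhds hη)).exists
  exact ⟨1 / ((k : ℝ) + 1), by positivity, hk⟩

theorem IsCooperativeSystem.exists_continuation (hn : 2 ≤ n) (hm : 1 ≤ m)
    (hΩ : IsSymmetricX1Domain Ω) (hf : IsAdmissibleNonlinearity f)
    (hU : IsCooperativeSystem m a f Ω U) {μ : ℝ} (hμ : 0 < μ)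
    (h : ∀ i < m, ∀ x ∈ puncturedCap Ω μ, 0 ≤ reflectDiff μ (U i) x) :
    ∃ δ > 0, ∀ c > 0, μ - δ < c → c ≤ μ →
      ∀ i < m, ∀ x ∈ puncturedCap Ω c, 0 ≤ reflectDiff c (U i) x := by
  have hpos := hU.reflectDiff_pos hn hm hΩ hf hμ h
  obtain ⟨η, hη, hsmall⟩ := hU.exists_small hn hm hΩ hf
  have hη2 : 0 < η / 2 := ENNReal.half_pos hη.ne'
  have hDfin : volume (puncturedCap Ω μ) ≠ ⊤ :=
    ((measure_mono inter_subset_left).trans_lt hΩ.isBounded.measure_lt_top).ne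
  obtain ⟨K, hKD, hK, hKv⟩ := (isOpen_puncturedCap hΩ.isOpen (c := μ)).measurableSet
    |>.exists_isCompact_sdiff_lt hDfin hη2.ne'
  obtain ⟨δ₁, hδ₁, hslab⟩ := exists_volume_slab_lt hΩ μ hη2
  have hKpos : ∀ᶠ c in 𝓝 μ, ∀ x ∈ K, 0 < reflectDiff c (U 0) x := by
    refine hK.eventually_forall_of_forall_eventually fun x hx => ?_
    have hxD := hKD hx
    have hc1 := (hU.contDiffOn 0 hm).continuousOn.continuousAt
      (hΩ.isOpen_diff.mem_nhds (hΩ.reflectAt_mem_of_mem_puncturedCap hμ.le hxD))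
    have hc2 := (hU.contDiffOn 0 hm).continuousOn.continuousAt
      (hΩ.isOpen_diff.mem_nhds (puncturedCap_subset hμ.le hxD))
    have hc : ContinuousAt (fun p : ℝ × EuclideanSpace ℝ (Fin n) => reflectDiff p.1 (U 0) p.2)
        (μ, x) :=
      (ContinuousAt.comp (f := fun p : ℝ × EuclideanSpace ℝ (Fin n) => reflectAt p.1 p.2)
        (x := (μ, x)) hc1 continuous_reflectAt_uncurry.continuousAt).sub
        (ContinuousAt.comp (f := Prod.snd) (x := (μ, x)) hc2 continuous_snd.continuousAt)
    exact hc.eventually (lt_mem_nhds (hpos x hxD))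
  obtain ⟨δ₂, hδ₂, hball⟩ := Metric.eventually_nhds_iff.1 hKpos
  refine ⟨min δ₁ δ₂, lt_min hδ₁ hδ₂, fun c hc hδc hcμ => ?_⟩
  -- The exceptional set: the old cap outside the compact set, the newly swept slab, and the mirror
  -- image of the origin in the old plane, which the old cap omits but the new one may contain.
  refine hsmall c hc ((puncturedCap Ω μ \ K ∪ (Ω ∩ ({x | μ - δ₁ < x 0} ∩ {x | x 0 ≤ μ}))) ∪
    {reflectAt μ 0}) ?_ ?_
  · have : Nontrivial (EuclideanSpace ℝ (Fin n)) :=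
      Module.nontrivial_of_finrank_pos (R := ℝ) (by simp; omega)
    calc _ ≤ volume (puncturedCap Ω μ \ K) + volume (Ω ∩ ({x | μ - δ₁ < x 0} ∩ {x | x 0 ≤ μ})) +
          volume {reflectAt μ (0 : EuclideanSpace ℝ (Fin n))} :=
          (measure_union_le _ _).trans (add_le_add_left (measure_union_le _ _) _)
      _ ≤ η / 2 + η / 2 + 0 := by
          gcongr
          exact (measure_singleton _).le
      _ = η := by rw [add_zero, ENNReal.add_halves]
  · intro x hx hxA
    simp only [mem_union, not_or] at hxA
    have hxμ : μ < x 0 := by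
      by_contra! hle
      refine hxA.1.2 ⟨hx.1, ?_, hle⟩
      have h1 : c < x 0 := hx.2.1
      have := min_le_left δ₁ δ₂
      rw [mem_ofPred_eq]
      linarith
    have hxD : x ∈ puncturedCap Ω μ := ⟨hx.1, hxμ, fun h0 => hxA.2 <| by
      rw [mem_singleton_iff, ← h0, reflectAt_reflectAt]⟩
    have hxK : x ∈ K := by
      by_contra hxK
      exact hxA.1.1 ⟨hxD, hxK⟩
    refine (hball (y := c) ?_ x hxK).le
    rw [Real.dist_eq, abs_lt]
    have := min_le_right δ₁ δ₂
    constructor <;> linarith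

theorem IsCooperativeSystem.reflectDiff_tendsto (hΩ : IsSymmetricX1Domain Ω)
    (hU : IsCooperativeSystem m a f Ω U) {i : ℕ} (hi : i < m) {μ : ℝ}
    {x : EuclideanSpace ℝ (Fin n)} (hx : reflectAt μ x ∈ Ω \ {0}) :
    Tendsto (fun c => reflectDiff c (U i) x) (𝓝 μ) (𝓝 (reflectDiff μ (U i) x)) := by
  have hc := (hU.contDiffOn i hi).continuousOn.continuousAt (hΩ.isOpen_diff.mem_nhds hx)
  have hr : Continuous fun c : ℝ => reflectAt c x :=
    continuous_reflectAt_uncurry.comp (continuous_id.prodMk continuous_const)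
  exact (hc.tendsto.comp hr.continuousAt.tendsto).sub_const _

theorem eventually_mem_puncturedCap {μ : ℝ} {x : EuclideanSpace ℝ (Fin n)}
    (hx : x ∈ puncturedCap Ω μ) : ∀ᶠ c in 𝓝 μ, x ∈ puncturedCap Ω c := by
  have hr : Continuous fun c : ℝ => reflectAt c x :=
    continuous_reflectAt_uncurry.comp (continuous_id.prodMk continuous_const)
  filter_upwards [gt_mem_nhds (show μ < x 0 from hx.2.1), hr.continuousAt.eventually_ne hx.2.2]
    with c h1 h2 using ⟨hx.1, h1, h2⟩

theorem IsCooperativeSystem.reflectDiff_nonneg (hn : 2 ≤ n) (hm : 1 ≤ m)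
    (hΩ : IsSymmetricX1Domain Ω) (hf : IsAdmissibleNonlinearity f)
    (hU : IsCooperativeSystem m a f Ω U) :
    ∀ c > 0, ∀ i < m, ∀ x ∈ puncturedCap Ω c, 0 ≤ reflectDiff c (U i) x := by
  set S : Set ℝ := {c | 0 < c ∧ ∀ c' ≥ c, ∀ i < m, ∀ x ∈ puncturedCap Ω c',
    0 ≤ reflectDiff c' (U i) x} with hS
  obtain ⟨d, hd, hdiam⟩ := hΩ.exists_diam
  -- Since `0 ∈ Ω`, caps at height `d` or more are empty, so the method starts for free.
  have hdS : d ∈ S := by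
    refine ⟨hd, fun c' hc' i hi x hx => ?_⟩
    have h1 := hdiam x hx.1 0 hΩ.zero_mem
    have h2 : c' < x 0 := hx.2.1
    have h3 := PiLp.norm_apply_le x 0
    rw [dist_zero_right] at h1
    have h4 := le_abs_self (x 0)
    rw [Real.norm_eq_abs] at h3
    linarith
  have hSb : BddBelow S := ⟨0, fun c hc => hc.1.le⟩
  set μ := sInf S with hμ
  have hμ0 : 0 ≤ μ := le_csInf ⟨d, hdS⟩ fun c hc => hc.1.le
  have hgt : ∀ c > μ, ∀ i < m, ∀ x ∈ puncturedCap Ω c, 0 ≤ reflectDiff c (U i) x := by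
    intro c hc
    obtain ⟨c₀, hc₀, hlt⟩ := exists_lt_of_csInf_lt ⟨d, hdS⟩ hc
    exact hc₀.2 c hlt.le
  rcases hμ0.eq_or_lt with h0 | hpos
  · rw [← h0] at hgt
    exact hgt
  exfalso
  have hat : ∀ i < m, ∀ x ∈ puncturedCap Ω μ, 0 ≤ reflectDiff μ (U i) x := by
    intro i hi x hx
    have hlim := (hU.reflectDiff_tendsto hΩ hi
      (hΩ.reflectAt_mem_of_mem_puncturedCap hμ0 hx)).mono_left (nhdsWithin_le_nhds (s := Ioi μ))
    refine ge_of_tendsto hlim ?_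
    filter_upwards [nhdsWithin_le_nhds (eventually_mem_puncturedCap hx), self_mem_nhdsWithin]
      with c h1 h2 using hgt c h2 i hi x h1
  obtain ⟨δ, hδ, hcont⟩ := hU.exists_continuation hn hm hΩ hf hpos hat
  set c₁ := max (μ / 2) (μ - δ / 2) with hc₁
  have hc₁lt : c₁ < μ := max_lt (by linarith) (by linarith)
  have hc₁S : c₁ ∈ S := by
    have hc₁pos : 0 < c₁ := (half_pos hpos).trans_le (le_max_left _ _)
    refine ⟨hc₁pos, fun c hc => ?_⟩
    rcases le_or_gt c μ with hle | hlt
    · have := le_max_right (μ / 2) (μ - δ / 2)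
      exact hcont c (hc₁pos.trans_le hc) (by linarith) hle
    · exact hgt c hlt
  exact absurd (csInf_le hSb hc₁S) (not_le.2 hc₁lt)

theorem IsCooperativeSystem.strictAnti (hn : 2 ≤ n) (hm : 1 ≤ m)
    (hΩ : IsSymmetricX1Domain Ω) (hf : IsAdmissibleNonlinearity f)
    (hU : IsCooperativeSystem m a f Ω U) {p q : EuclideanSpace ℝ (Fin n)} (hq : q ∈ Ω)
    (hpq : ∀ j, j ≠ 0 → p j = q j) (hp : 0 < p 0) (hlt : p 0 < q 0) : U 0 q < U 0 p := by
  -- The midpoint plane exchanges the two points, so strict positivity of the difference at `q` is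
  -- the claim.
  have hr : reflectAt ((p 0 + q 0) / 2) q = p := by
    ext j
    by_cases hj : j = 0
    · subst hj; simp; ring
    · rw [reflectAt_apply_of_ne _ _ hj, hpq j hj]
  have hqD : q ∈ puncturedCap Ω ((p 0 + q 0) / 2) := by
    refine ⟨hq, ?_, ?_⟩
    · rw [mem_ofPred_eq]; linarith
    · rw [mem_ofPred_eq, hr]
      exact ne_zero_of_apply_zero_pos hp
  have hc : 0 < (p 0 + q 0) / 2 := by linarith
  have h := hU.reflectDiff_pos hn hm hΩ hf hc (hU.reflectDiff_nonneg hn hm hΩ hf _ hc) q hqD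
  simp only [reflectDiff, hr] at h
  linarith

theorem IsCooperativeSystem.le_reflectX1 (hn : 2 ≤ n) (hm : 1 ≤ m)
    (hΩ : IsSymmetricX1Domain Ω) (hf : IsAdmissibleNonlinearity f)
    (hU : IsCooperativeSystem m a f Ω U) {x : EuclideanSpace ℝ (Fin n)} (hx : x ∈ Ω)
    (hx0 : 0 < x 0) : U 0 x ≤ U 0 (reflectX1 x) := by
  have hxD : x ∈ puncturedCap Ω 0 := by
    refine ⟨hx, hx0, fun h => ?_⟩
    have := congrArg (fun y : EuclideanSpace ℝ (Fin n) => y 0) h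
    simp at this
    linarith
  have hlim := (hU.reflectDiff_tendsto hΩ (i := 0) hm
    (hΩ.reflectAt_mem_of_mem_puncturedCap le_rfl hxD)).mono_left (nhdsWithin_le_nhds (s := Ioi 0))
  have h : 0 ≤ reflectDiff 0 (U 0) x := by
    refine ge_of_tendsto hlim ?_
    filter_upwards [nhdsWithin_le_nhds (eventually_mem_puncturedCap hxD), self_mem_nhdsWithin]
      with c h1 h2 using hU.reflectDiff_nonneg hn hm hΩ hf c h2 0 hm x h1
  simp only [reflectDiff, reflectAt_zero] at h
  linarith

/-- Applying the one-sided inequality to the mirrored system supplies the reverse inequality needed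
for symmetry. -/
theorem IsCooperativeSystem.comp_reflect (hΩ : IsSymmetricX1Domain Ω)
    (hU : IsCooperativeSystem m a f Ω U) :
    IsCooperativeSystem m a f Ω fun i x => U i (reflectAt 0 x) := by
  have hmem : ∀ x ∈ Ω \ {0}, reflectAt 0 x ∈ Ω \ {0} := fun x hx => by
    refine ⟨by rw [reflectAt_zero]; exact hΩ.symmetric x hx.1, fun h => hx.2 ?_⟩
    have h0 : reflectAt 0 x = 0 := h
    rw [mem_singleton_iff, ← reflectAt_reflectAt 0 x, h0, reflectAt_of_apply_zero_eq]
    rfl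
  refine ⟨hU.coeff_nonneg, fun i hi => ?_, fun i hi x hx => ?_, fun x hx => hU.last_eq _ (hmem x hx),
    fun x hx => hU.pos _ (hmem x hx), fun i hi y hy => ?_, fun i hi => ?_⟩
  · exact (hU.contDiffOn i hi).comp (contDiff_reflectAt 0).contDiffOn hmem
  · rw [laplacian_comp_reflectAt 0
      ((hU.contDiffOn i hi).contDiffAt (hΩ.isOpen_diff.mem_nhds (hmem x hx))),
      hU.laplacian_eq i hi _ (hmem x hx)]
  · have hyf : reflectAt 0 y ∈ frontier Ω := by
      have hmaps : MapsTo (reflectAt 0) Ω Ω := fun x hx => by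
        rw [reflectAt_zero]; exact hΩ.symmetric x hx
      refine ⟨map_mem_closure (continuous_reflectAt 0) hy.1 hmaps, fun h => hy.2 ?_⟩
      rw [hΩ.isOpen.interior_eq] at h ⊢
      rw [← reflectAt_reflectAt 0 y]
      exact hmaps h
    refine (hU.tendsto_frontier i hi _ hyf).comp (tendsto_nhdsWithin_iff.2
      ⟨(continuous_reflectAt 0).continuousAt.tendsto.mono_left nhdsWithin_le_nhds, ?_⟩)
    filter_upwards [self_mem_nhdsWithin] with x hx using hmem x hx
  · refine (hU.bddBelow i hi).mono ?_
    rintro _ ⟨x, hx, rfl⟩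
    exact mem_image_of_mem _ (hmem x hx)

theorem IsCooperativeSystem.symmetric (hn : 2 ≤ n) (hm : 1 ≤ m)
    (hΩ : IsSymmetricX1Domain Ω) (hf : IsAdmissibleNonlinearity f)
    (hU : IsCooperativeSystem m a f Ω U) {x : EuclideanSpace ℝ (Fin n)} (hx : x ∈ Ω) :
    U 0 (reflectX1 x) = U 0 x := by
  have hinv : ∀ x : EuclideanSpace ℝ (Fin n), reflectX1 (reflectX1 x) = x := fun x => by
    rw [← reflectAt_zero, reflectAt_reflectAt]
  have hpos : ∀ x ∈ Ω, 0 < x 0 → U 0 (reflectX1 x) = U 0 x := fun x hx h0 => by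
    refine le_antisymm ?_ (hU.le_reflectX1 hn hm hΩ hf hx h0)
    have h := (hU.comp_reflect hΩ).le_reflectX1 hn hm hΩ hf hx h0
    simpa only [reflectAt_zero, hinv] using h
  rcases lt_trichotomy (x 0) 0 with h | h | h
  · have h' : 0 < reflectX1 x 0 := by
      rw [← reflectAt_zero, reflectAt_apply_zero]; linarith
    have := hpos _ (hΩ.symmetric x hx) h'
    rw [hinv] at this
    exact this.symm
  -- Points of the plane are fixed; this covers the origin, where nothing is known about `u`.
  · rw [← reflectAt_zero, reflectAt_of_apply_zero_eq h]
  · exact hpos x hx h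

end MovingPlanes

/-! ### Factoring the operator into a cooperative system. -/

section Reduction

variable {n : ℕ} {m : ℕ}

/-- If `α i < 0`, the product vanishes at `t = -α i > 0`, but there its leading term is positive and
the others are nonnegative. -/
theorem nonneg_of_symmCoeff_nonneg {α : Fin m → ℝ} (hα : ∀ k < m, 0 ≤ symmCoeff α k) (i : Fin m) :
    0 ≤ α i := by
  by_contra! hneg
  have h := det_diagonal_add_eq_sum_symmCoeff α (-α i)
  rw [Matrix.det_diagonal, Finset.prod_eq_zero (Finset.mem_univ i) (by ring),
    Finset.sum_range_succ] at h
  have h1 : 0 ≤ ∑ k ∈ Finset.range m, symmCoeff α k * (-α i) ^ k :=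
    Finset.sum_nonneg fun k hk =>
      mul_nonneg (hα k (Finset.mem_range.1 hk)) (pow_nonneg (by linarith) k)
  have h2 : symmCoeff α m = 1 := by simp [symmCoeff]
  have h3 : 0 < (-α i) ^ m := pow_pos (by linarith) m
  rw [h2, one_mul] at h
  linarith

open Polynomial in
/-- The polynomial `∏_{j < i} (X + aⱼ)`. -/
noncomputable def shiftProd (a : ℕ → ℝ) (i : ℕ) : ℝ[X] :=
  ∏ j ∈ Finset.range i, (X + C (a j))

open Polynomial in
theorem shiftProd_succ (a : ℕ → ℝ) (i : ℕ) :
    shiftProd a (i + 1) = shiftProd a i * X + shiftProd a i * C (a i) := by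
  rw [shiftProd, Finset.prod_range_succ, mul_add]; rfl

theorem coeff_shiftProd_of_lt (a : ℕ → ℝ) {i k : ℕ} (h : i < k) : (shiftProd a i).coeff k = 0 := by
  induction i generalizing k with
  | zero => simp [shiftProd, Polynomial.coeff_one, h.ne']
  | succ i ih =>
    obtain ⟨k, rfl⟩ : ∃ l, k = l + 1 := ⟨k - 1, by omega⟩
    rw [shiftProd_succ, Polynomial.coeff_add, Polynomial.coeff_mul_X, Polynomial.coeff_mul_C,
      ih (by omega), ih (by omega)]
    simp

/-- Needed so that lower bounds for the powers of `-Δ` on `u` combine into lower bounds for the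
components. -/
theorem coeff_shiftProd_nonneg {a : ℕ → ℝ} {i : ℕ} (ha : ∀ j < i, 0 ≤ a j) (k : ℕ) :
    0 ≤ (shiftProd a i).coeff k := by
  induction i generalizing k with
  | zero =>
    simp only [shiftProd, Finset.range_zero, Finset.prod_empty, Polynomial.coeff_one]
    split <;> norm_num
  | succ i ih =>
    have ih' := ih fun j hj => ha j (by omega)
    rw [shiftProd_succ, Polynomial.coeff_add, Polynomial.coeff_mul_C]
    refine add_nonneg ?_ (mul_nonneg (ih' k) (ha i (by omega)))
    cases k with
    | zero => simp
    | succ k => rw [Polynomial.coeff_mul_X]; exact ih' k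

/-- The coefficients `α`, extended by zero. -/
noncomputable def extendCoeff (α : Fin m → ℝ) (j : ℕ) : ℝ := if h : j < m then α ⟨j, h⟩ else 0

theorem coeff_shiftProd_extendCoeff (α : Fin m → ℝ) {k : ℕ} (hk : k ≤ m) :
    (shiftProd (extendCoeff α) m).coeff k = symmCoeff α k := by
  have h : shiftProd (extendCoeff α) m =
      ∑ k ∈ Finset.range (m + 1), Polynomial.C (symmCoeff α k) * Polynomial.X ^ k := by
    refine Polynomial.funext fun t => ?_
    have h1 := det_diagonal_add_eq_sum_symmCoeff α t
    rw [Matrix.det_diagonal] at h1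
    simp only [shiftProd, Polynomial.eval_prod, Polynomial.eval_add, Polynomial.eval_X,
      Polynomial.eval_C, Polynomial.eval_finsetSum, Polynomial.eval_mul, Polynomial.eval_pow]
    rw [← h1, Finset.prod_range]
    exact Finset.prod_congr rfl fun i _ => by simp [extendCoeff, add_comm]
  rw [h, Polynomial.finsetSum_coeff]
  simp only [Polynomial.coeff_C_mul_X_pow]
  rw [Finset.sum_ite_eq, if_pos (Finset.mem_range.2 (by omega))]

theorem negLaplacianPow_succ (k : ℕ) (u : EuclideanSpace ℝ (Fin n) → ℝ) :
    negLaplacianPow (k + 1) u = -Laplacian.laplacian (negLaplacianPow k u) :=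
  Function.iterate_succ_apply' _ _ _

theorem contDiffOn_negLaplacianPow {s : Set (EuclideanSpace ℝ (Fin n))} (hs : IsOpen s)
    {u : EuclideanSpace ℝ (Fin n) → ℝ} (k : ℕ) {r : ℕ}
    (hu : ContDiffOn ℝ ((r + 2 * k : ℕ) : WithTop ℕ∞) u s) :
    ContDiffOn ℝ (r : WithTop ℕ∞) (negLaplacianPow k u) s := by
  induction k generalizing r with
  | zero => simpa [negLaplacianPow] using hu
  | succ k ih =>
    rw [negLaplacianPow_succ]
    refine (ContDiffOn.laplacian hs (ih ?_)).neg
    rwa [show r + 2 + 2 * k = r + 2 * (k + 1) by ring]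

/-- `∏_{j < i} (-Δ + aⱼ)` applied to `u`, written out in powers of `-Δ`. -/
noncomputable def systemComponent (a : ℕ → ℝ) (u : EuclideanSpace ℝ (Fin n) → ℝ) (i : ℕ) :
    EuclideanSpace ℝ (Fin n) → ℝ := fun x =>
  ∑ k ∈ Finset.range (i + 1), (shiftProd a i).coeff k * negLaplacianPow k u x

theorem systemComponent_zero (a : ℕ → ℝ) (u : EuclideanSpace ℝ (Fin n) → ℝ) :
    systemComponent a u 0 = u := by
  funext x
  simp [systemComponent, shiftProd, negLaplacianPow]

/-- Multiplication by `X + a i`, read on coefficients. This is pure algebra and needs no smoothness;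
linearity of the Laplacian enters only through `laplacian_sum_mul`. -/
theorem systemComponent_succ (a : ℕ → ℝ) (u : EuclideanSpace ℝ (Fin n) → ℝ) (i : ℕ)
    (x : EuclideanSpace ℝ (Fin n)) :
    systemComponent a u (i + 1) x =
      ∑ k ∈ Finset.range (i + 1), (shiftProd a i).coeff k * negLaplacianPow (k + 1) u x +
      a i * systemComponent a u i x := by
  have h0 : (shiftProd a i).coeff (i + 1) = 0 := coeff_shiftProd_of_lt a (by omega)
  simp only [systemComponent, shiftProd_succ, Polynomial.coeff_add, Polynomial.coeff_mul_C, add_mul,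
    Finset.sum_add_distrib]
  congr 1
  · rw [Finset.sum_range_succ']
    simp
  · rw [Finset.sum_range_succ, h0, Finset.mul_sum]
    simp only [zero_mul, add_zero]
    exact Finset.sum_congr rfl fun k _ => by ring

theorem laplacian_sum_mul {E : Type*} [NormedAddCommGroup E] [InnerProductSpace ℝ E]
    [FiniteDimensional ℝ E] {ι : Type*} (s : Finset ι) (b : ι → ℝ) (g : ι → E → ℝ) {x : E}
    (hg : ∀ k ∈ s, ContDiffAt ℝ 2 (g k) x) :
    Laplacian.laplacian (fun y => ∑ k ∈ s, b k * g k y) x =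
      ∑ k ∈ s, b k * Laplacian.laplacian (g k) x := by
  classical
  induction s using Finset.induction_on with
  | empty => simp
  | insert k s hk ih =>
    have h1 : ContDiffAt ℝ 2 (b k • g k) x := (hg k (by simp)).const_smul (b k)
    have h2 : ContDiffAt ℝ 2 (fun y => ∑ k ∈ s, b k * g k y) x :=
      ContDiffAt.sum fun j hj => contDiffAt_const.mul (hg j (by simp [hj]))
    have h3 := h1.laplacian_add h2
    rw [InnerProductSpace.laplacian_smul _ (hg k (by simp)),
      ih fun j hj => hg j (by simp [hj])] at h3
    rw [Finset.sum_insert hk]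
    refine Eq.trans (congrFun (congrArg Laplacian.laplacian (funext fun y => ?_)) x) h3
    simp [Finset.sum_insert hk]

/-- A component of index `i < m` involves only the powers `(-Δ)^k u` with `k ≤ i < m`: these are
`C²` and covered by the boundary conditions and the lower bounds, positivity of `u` serving for `k =
0`. -/
theorem IsPositiveNavierSolution.isCooperativeSystem [NeZero n] {α : Fin m → ℝ} {f : ℝ → ℝ}
    {Ω : Set (EuclideanSpace ℝ (Fin n))} {u : EuclideanSpace ℝ (Fin n) → ℝ}
    (hα : ∀ k < m, 0 ≤ symmCoeff α k) (hΩ : IsSymmetricX1Domain Ω)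
    (hu : IsPositiveNavierSolution α f Ω u) :
    IsCooperativeSystem m (extendCoeff α) f Ω (systemComponent (extendCoeff α) u) := by
  have ha : ∀ j, 0 ≤ extendCoeff α j := fun j => by
    unfold extendCoeff
    split
    · exact nonneg_of_symmCoeff_nonneg hα _
    · exact le_rfl
  have hopen := hΩ.isOpen_diff
  have hsmooth : ∀ k < m, ContDiffOn ℝ 2 (negLaplacianPow k u) (Ω \ {0}) := fun k hk =>
    contDiffOn_negLaplacianPow hopen k (r := 2)
      (hu.contDiffOn.of_le (by exact_mod_cast (by omega : 2 + 2 * k ≤ 2 * m)))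
  refine ⟨fun i _ => ha i, fun i hi => ?_, fun i hi x hx => ?_, fun x hx => ?_, fun x hx => ?_,
    fun i hi y hy => ?_, fun i hi => ?_⟩
  · refine ContDiffOn.sum fun k hk => contDiffOn_const.mul (hsmooth k ?_)
    have := Finset.mem_range.1 hk
    omega
  · rw [systemComponent_succ]
    unfold systemComponent
    rw [laplacian_sum_mul _ _ _ fun k hk => ?_]
    · simp only [negLaplacianPow_succ, Pi.neg_apply, mul_neg, Finset.sum_neg_distrib]
      ring
    · have := Finset.mem_range.1 hk
      exact (hsmooth k (by omega)).contDiffAt (hopen.mem_nhds hx)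
  · rw [systemComponent_zero, ← hu.equation x hx]
    refine Finset.sum_congr rfl fun k hk => ?_
    rw [coeff_shiftProd_extendCoeff α (by have := Finset.mem_range.1 hk; omega)]
  · rw [systemComponent_zero]
    exact hu.pos x hx
  · have h : Tendsto (systemComponent (extendCoeff α) u i) (𝓝[Ω \ {0}] y)
        (𝓝 (∑ k ∈ Finset.range (i + 1), (shiftProd (extendCoeff α) i).coeff k * 0)) := by
      refine tendsto_finsetSum _ fun k hk => (hu.navier k ?_ y hy).const_mul _
      have := Finset.mem_range.1 hk
      omega
    simpa using h
  · have hb : ∀ k < m, ∃ b, ∀ x ∈ Ω \ {0}, b ≤ negLaplacianPow k u x := by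
      intro k hk
      rcases Nat.eq_zero_or_pos k with rfl | hk0
      · exact ⟨0, fun x hx => (hu.pos x hx).le⟩
      · obtain ⟨b, hb⟩ := hu.boundedBelow k hk0 hk
        exact ⟨b, fun x hx => hb (mem_image_of_mem _ hx)⟩
    choose! b hb using hb
    refine ⟨∑ k ∈ Finset.range (i + 1), (shiftProd (extendCoeff α) i).coeff k * b k, ?_⟩
    rintro _ ⟨x, hx, rfl⟩
    refine Finset.sum_le_sum fun k hk => mul_le_mul_of_nonneg_left (hb k ?_ x hx)
      (coeff_shiftProd_nonneg (fun j _ => ha j) k)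
    have := Finset.mem_range.1 hk
    omega

end Reduction

theorem theorem1p2 {n m : ℕ} [NeZero n] (hn : 2 ≤ n) (hm : 1 ≤ m)
    (α : Fin m → ℝ) (hα : ∀ k < m, 0 ≤ symmCoeff α k)
    (Ω : Set (EuclideanSpace ℝ (Fin n))) (hΩ : IsSymmetricX1Domain Ω)
    (f : ℝ → ℝ) (hf : IsAdmissibleNonlinearity f)
    (u : EuclideanSpace ℝ (Fin n) → ℝ) (hu : IsPositiveNavierSolution α f Ω u) :
    (∀ x ∈ Ω, u (reflectX1 x) = u x) ∧
    (∀ p ∈ Ω, ∀ q ∈ Ω, (∀ j, j ≠ 0 → p j = q j) → 0 < p 0 → p 0 < q 0 → u q < u p) := by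
  have hU := hu.isCooperativeSystem hα hΩ
  refine ⟨fun x hx => ?_, fun p _ q hq hpq hp hlt => ?_⟩
  · simpa only [systemComponent_zero] using hU.symmetric hn hm hΩ hf hx
  · simpa only [systemComponent_zero] using hU.strictAnti hn hm hΩ hf hq hpq hp hlt
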